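/- Let $k$ be a field. A colored vector space $(V,G)$ is a set $G$ together with a $k$-vector space with a $G$-bigrading $V=\bigoplus_{g,h\in G}{}^gV^h$. A reduced colored coalgebra $(C,G)$ is a colored vector space with a coassociative linear map $\Delta:C\to C\otimes C$ (no counit) such that $\Delta({}^gC^h)\subseteq\bigoplus_{s\in G}{}^gC^s\otimes{}^sC^h$ for all $g,h\in G$, and such that for every $x\in C$ there is an $n$ with $\Delta^n(x)=0$, where $\Delta^n:C\to C^{\otimes(n+1)}$ is the iterated comultiplication. A morphism $(f,a):(C,G)\to(D,S)$ consists of a map of sets $a:G\to S$ and a linear map $f:C\to D$ with $f({}^gC^h)\subseteq{}^{a(g)}D^{a(h)}$ and $(f\otimes f)\Delta=\Delta f$. A subcoalgebra of $(C,G)$ is a subspace $E\subseteq C$ with $E=\bigoplus_{g,h}(E\cap{}^gC^h)$ and $\Delta(E)\subseteq E\otimes E$; its color set is again $G$. The product of a family of colored vector spaces $(V_i,G_i)_{i\in I}$ is the colored vector space with color set $G=\prod_iG_i$ and underlying space $\bigoplus_{g,h\in G}\prod_{i\in I}{}^{g_i}V_i^{h_i}$, with the evident projections to the $(V_i,G_i)$.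 The reduced cofree colored coalgebra on $(V,G)$ is $\overline{C(V,G)}=\bigoplus_{n>0}V^{\square n}$ with color set $G$, where $V^{\square n}\subseteq V^{\otimes n}$ is the $n$-fold cotensor product over the set-like coalgebra $k[G]$, that is, the span of the tensors $x_1\otimes\cdots\otimes x_n$ with $x_j\in{}^{s_{j-1}}V^{s_j}$ for some $s_0,\dots,s_n\in G$ (such a tensor has bidegree $(s_0,s_n)$); its comultiplication is the deconcatenation $[x_1|\cdots|x_n]\mapsto\sum_{0<j<n}[x_1|\cdots|x_j]\otimes[x_{j+1}|\cdots|x_n]$. It has a projection onto $V=V^{\square 1}$. Theorem. The category of reduced colored coalgebras over $k$ has all small coequalizers and all small products. More precisely: (1) Let $(f,a),(g,b):(C,G)\to(D,S)$ be two morphisms, let $\sim$ be the equivalence relation on $S$ generated by $a(x)\sim b(x)$ for $x\in G$, and for $\sigma,\tau\in S/{\sim}$ put ${}^{\sigma}D^{\tau}=\bigoplus_{s\in\sigma,\,t\in\tau}{}^sD^t$. Then $D/\mathrm{Im}(f-g)$, with color set $S/{\sim}$ and with the image of ${}^{\sigma}D^{\tau}$ as its piece of bidegree $(\sigma,\tau)$,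 carries a reduced colored coalgebra structure for which the quotient maps $D\to D/\mathrm{Im}(f-g)$ and $S\to S/{\sim}$ form a morphism, and this morphism is a coequalizer of $(f,a)$ and $(g,b)$. (2) Let $(C_i,G_i)_{i\in I}$ be a small family of reduced colored coalgebras, and let $P$ be the reduced cofree colored coalgebra on the product of the underlying colored vector spaces, with color set $\prod_iG_i$; let $p_i:P\to C_i$ be the composite of the projection of $P$ onto this product with the projection to $C_i$. Among the subcoalgebras $E$ of $P$ such that all restrictions $p_i|_E:E\to C_i$ preserve the comultiplication there is a largest one $D$, namely the sum of all of them. With color set $\prod_iG_i$, the bigrading ${}^sD^t=D\cap{}^sP^t$ and the comultiplication restricted from $P$, $D$ is a reduced colored coalgebra, and together with the morphisms given by $p_i|_D$ and the projections $\prod_jG_j\to G_i$ it is a product of the family. -/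

import Mathlib

open CategoryTheory CategoryTheory.Limits
open scoped TensorProduct DirectSum

universe w v

namespace RedCol

section Tensor

variable (k : Type v) [Field k] (V : Type w) [AddCommGroup V] [Module k V]

/-- The iterated tensor power `V ⊗ (V ⊗ (⋯ ⊗ V))` with `n + 1` factors. -/
noncomputable def TPow : ℕ → ModuleCat.{w} k
  | 0 => ModuleCat.of k V
  | n + 1 => ModuleCat.of k (V ⊗[k] TPow n)

/-- The tensor power with one factor is `V`. -/
noncomputable def TPow.zeroEquiv : V ≃ₗ[k] TPow k V 0 :=
  LinearEquiv.refl k V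

/-- The recursive description of tensor powers. -/
noncomputable def TPow.succEquiv (n : ℕ) : V ⊗[k] TPow k V n ≃ₗ[k] TPow k V (n + 1) :=
  LinearEquiv.refl k (V ⊗[k] TPow k V n)

end Tensor

section Comul

variable {k : Type v} [Field k] {C : Type w} [AddCommGroup C] [Module k C]

/-- The iterated comultiplication `Δⁿ : C → C^{⊗(n+1)}`, `Δ⁰ = id`, `Δⁿ⁺¹ = (id ⊗ Δⁿ) ∘ Δ`. -/
noncomputable def iterComul (Δ : C →ₗ[k] C ⊗[k] C) : (n : ℕ) → C →ₗ[k] TPow k C n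
  | 0 => (TPow.zeroEquiv k C).toLinearMap
  | n + 1 => (TPow.succEquiv k C n).toLinearMap ∘ₗ LinearMap.lTensor C (iterComul Δ n) ∘ₗ Δ

/-- Coassociativity of a comultiplication (no counit is involved). -/
def Coassoc (Δ : C →ₗ[k] C ⊗[k] C) : Prop :=
  (TensorProduct.assoc k C C C).toLinearMap ∘ₗ LinearMap.rTensor C Δ ∘ₗ Δ =
    LinearMap.lTensor C Δ ∘ₗ Δ

/-- Conilpotency: every element is killed by some iterate of the comultiplication. -/
def Conilpotent (Δ : C →ₗ[k] C ⊗[k] C) : Prop :=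
  ∀ x : C, ∃ n : ℕ, iterComul Δ n x = 0

/-- For subspaces `M, N ⊆ C`, the subspace `M ⊗ N ⊆ C ⊗ C`. -/
noncomputable def tensorSub (M N : Submodule k C) : Submodule k (C ⊗[k] C) :=
  LinearMap.range (TensorProduct.mapIncl M N)

end Comul

/-- A colored vector space: a `G`-bigrading `V = ⨁_{g,h ∈ G} ᵍVʰ` on `V`
(the internal direct sum condition is `indep` together with `sup`). -/
structure ColoredSpace (k : Type v) [Field k] (G : Type w) (V : Type w)
    [AddCommGroup V] [Module k V] where
  piece : G → G → Submodule k V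
  indep : iSupIndep (fun p : G × G => piece p.1 p.2)
  sup : (⨆ p : G × G, piece p.1 p.2) = ⊤

/-- The structure of a reduced colored coalgebra `(C, G)` on a vector space `C` and a set `G`:
a `G`-bigrading and a coassociative conilpotent comultiplication (without counit) such that
`Δ(ᵍCʰ) ⊆ ⨁ₛ ᵍCˢ ⊗ ˢCʰ`. -/
structure ReducedColoredCoalgebra (k : Type v) [Field k] (G : Type w) (C : Type w)
    [AddCommGroup C] [Module k C] extends ColoredSpace k G C where
  comul : C →ₗ[k] C ⊗[k] C
  coassoc : Coassoc comul
  conilpotent : Conilpotent comul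
  comul_piece : ∀ g h : G, ∀ x ∈ piece g h, comul x ∈ ⨆ s : G, tensorSub (piece g s) (piece s h)

/-- A (bundled) reduced colored coalgebra `(carrier, Color)` over `k`. -/
structure RedColCoalg (k : Type v) [Field k] where
  Color : Type w
  carrier : Type w
  [addCommGroup : AddCommGroup carrier]
  [module : Module k carrier]
  str : ReducedColoredCoalgebra k Color carrier

attribute [instance] RedColCoalg.addCommGroup RedColCoalg.module

namespace RedColCoalg

variable {k : Type v} [Field k]

/-- Bundle a reduced colored coalgebra structure. -/
abbrev of {G C : Type w} [AddCommGroup C] [Module k C] (s : ReducedColoredCoalgebra k G C) :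
    RedColCoalg.{w, v} k where
  Color := G
  carrier := C
  str := s

/-- The homogeneous piece `ᵍXʰ`. -/
abbrev piece (X : RedColCoalg.{w, v} k) (g h : X.Color) : Submodule k X.carrier :=
  X.str.piece g h

/-- The comultiplication. -/
abbrev comul (X : RedColCoalg.{w, v} k) : X.carrier →ₗ[k] X.carrier ⊗[k] X.carrier :=
  X.str.comul

/-- Morphisms of reduced colored coalgebras: a map of colors together with a linear map that is
compatible with the bigradings and with the comultiplications. -/
@[ext]
structure Hom (X Y : RedColCoalg.{w, v} k) where
  color : X.Color → Y.Color
  lin : X.carrier →ₗ[k] Y.carrier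
  map_piece : ∀ g h : X.Color, ∀ x ∈ X.piece g h, lin x ∈ Y.piece (color g) (color h)
  map_comul : TensorProduct.map lin lin ∘ₗ X.comul = Y.comul ∘ₗ lin

/-- The category of reduced colored coalgebras over `k`. -/
instance : Category.{w} (RedColCoalg.{w, v} k) where
  Hom X Y := Hom X Y
  id X :=
    { color := id
      lin := LinearMap.id
      map_piece := fun _ _ _ hx => hx
      map_comul := by simp }
  comp {X Y Z} f g :=
    { color := g.color ∘ f.color
      lin := g.lin ∘ₗ f.lin
      map_piece := fun _ _ x hx => g.map_piece _ _ _ (f.map_piece _ _ x hx)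
      map_comul := by
        rw [TensorProduct.map_comp, LinearMap.comp_assoc, f.map_comul, ← LinearMap.comp_assoc,
          g.map_comul, LinearMap.comp_assoc] }

/-- A (bigraded) subcoalgebra of `X`, with the same set of colors: a subspace `E` with
`E = ⨁ (E ∩ ᵍXʰ)` and `Δ(E) ⊆ E ⊗ E`. -/
structure IsSubcoalgebra (X : RedColCoalg.{w, v} k) (E : Submodule k X.carrier) : Prop where
  homogeneous : E ≤ ⨆ p : X.Color × X.Color, E ⊓ X.piece p.1 p.2
  comul_mem : ∀ x ∈ E, X.comul x ∈ tensorSub E E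

end RedColCoalg

/-! ### Deconcatenation on the reduced tensor coalgebra -/

section Bar

variable (k : Type v) [Field k] (V : Type w) [AddCommGroup V] [Module k V]

/-- The reduced tensor coalgebra `⨁_{n > 0} V^{⊗n}` (the summand of index `n` is
`V^{⊗(n+1)}`). -/
abbrev Bar : Type w := ⨁ n : ℕ, TPow k V n

variable {V}

/-- The inclusion of `V^{⊗(n+1)}`. -/
noncomputable def Bar.ι (n : ℕ) : TPow k V n →ₗ[k] Bar k V :=
  DirectSum.lof k ℕ (fun n => TPow k V n) n

/-- The inclusion of `V` as the bars `[v]` of length one. -/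
noncomputable def Bar.single : V →ₗ[k] Bar k V :=
  Bar.ι k 0 ∘ₗ (TPow.zeroEquiv k V).toLinearMap

/-- Prepending a letter: `v ↦ ([x₁|⋯|xₙ] ↦ [v|x₁|⋯|xₙ])`. -/
noncomputable def Bar.cons : V →ₗ[k] Bar k V →ₗ[k] Bar k V :=
  LinearMap.flip <| DirectSum.toModule k ℕ (V →ₗ[k] Bar k V) fun n =>
    ((TensorProduct.mk k V (TPow k V n)).compr₂
      (Bar.ι k (n + 1) ∘ₗ (TPow.succEquiv k V n).toLinearMap)).flip

/-- Deconcatenation on bars of length `n + 1`: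
`Δ[v] = 0` and `Δ[v|x₁|⋯|xₙ] = [v] ⊗ [x₁|⋯|xₙ] + ([v|-] ⊗ id) Δ[x₁|⋯|xₙ]`. -/
noncomputable def Bar.deconAux : (n : ℕ) → TPow k V n →ₗ[k] Bar k V ⊗[k] Bar k V
  | 0 => 0
  | n + 1 =>
    (TensorProduct.map (Bar.single k) (Bar.ι k n) +
      TensorProduct.lift
        ((LinearMap.rTensorHom (Bar k V) ∘ₗ Bar.cons k).compl₂ (Bar.deconAux n))) ∘ₗ
      (TPow.succEquiv k V n).symm.toLinearMap

/-- The deconcatenation comultiplication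
`Δ[x₁|⋯|xₙ] = ∑_{0 < i < n} [x₁|⋯|xᵢ] ⊗ [xᵢ₊₁|⋯|xₙ]`. -/
noncomputable def Bar.decon : Bar k V →ₗ[k] Bar k V ⊗[k] Bar k V :=
  DirectSum.toModule k ℕ _ (Bar.deconAux k)

/-- The projection onto the bars of length one. -/
noncomputable def Bar.proj : Bar k V →ₗ[k] V :=
  (TPow.zeroEquiv k V).symm.toLinearMap ∘ₗ
    DirectSum.component k ℕ (fun n => TPow k V n) 0

end Bar

section Cofree

variable {k : Type v} [Field k] {G V : Type w} [AddCommGroup V] [Module k V]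

/-- The part `ᵍ(V^{□(n+1)})ʰ ⊆ V^{⊗(n+1)}` of the iterated cotensor product of `V` over `k[G]`:
it is spanned by the tensors `x₀ ⊗ ⋯ ⊗ xₙ` with `xᵢ` of bidegree `(sᵢ, sᵢ₊₁)`,
where `s₀ = g` and `sₙ₊₁ = h`. -/
noncomputable def ColoredSpace.box (A : ColoredSpace k G V) :
    (n : ℕ) → G → G → Submodule k (TPow k V n)
  | 0, g, h => (A.piece g h).map (TPow.zeroEquiv k V).toLinearMap
  | n + 1, g, h =>
    (⨆ s : G, LinearMap.range (TensorProduct.mapIncl (A.piece g s) (A.box n s h))).map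
      (TPow.succEquiv k V n).toLinearMap

/-- The bidegree `(g, h)` part of the reduced cofree colored coalgebra, inside the reduced tensor
coalgebra. -/
noncomputable def ColoredSpace.barPiece (A : ColoredSpace k G V) (g h : G) :
    Submodule k (Bar k V) :=
  ⨆ n : ℕ, (A.box n g h).map (Bar.ι k n)

/-- The underlying space `⨁_{n > 0} V^{□n}` of the reduced cofree colored coalgebra, inside the
reduced tensor coalgebra. -/
noncomputable def ColoredSpace.barSub (A : ColoredSpace k G V) : Submodule k (Bar k V) :=
  ⨆ p : G × G, A.barPiece p.1 p.2

end Cofree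

section BarFacts

variable {k : Type v} [Field k] {V : Type w} [AddCommGroup V] [Module k V]

lemma Bar.cons_ι (v : V) (n : ℕ) (x : TPow k V n) :
    Bar.cons k v (Bar.ι k n x) = Bar.ι k (n + 1) (TPow.succEquiv k V n (v ⊗ₜ x)) := by
  simp [Bar.cons, Bar.ι]

@[elab_as_elim]
lemma Bar.induction {P : Bar k V → Prop} (x : Bar k V) (zero : P 0)
    (add : ∀ x y, P x → P y → P (x + y)) (single : ∀ v, P (Bar.single k v))
    (cons : ∀ v y, P y → P (Bar.cons k v y)) : P x := by
  have key : ∀ n (x : TPow k V n), P (Bar.ι k n x) := by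
    intro n
    induction n with
    | zero => intro x; exact single ((TPow.zeroEquiv k V).symm x)
    | succ n ih =>
      intro x
      obtain ⟨t, rfl⟩ := (TPow.succEquiv k V n).surjective x
      induction t with
      | zero => simpa using zero
      | add a b ha hb => rw [map_add, map_add]; exact add _ _ ha hb
      | tmul v y => rw [← Bar.cons_ι]; exact cons _ _ (ih y)
  induction x using DirectSum.induction_on with
  | zero => exact zero
  | of n x => exact key n x
  | add a b ha hb => exact add _ _ ha hb

lemma Bar.decon_ι (n : ℕ) (x : TPow k V n) :
    Bar.decon k (Bar.ι k n x) = Bar.deconAux k n x := by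
  simp [Bar.decon, Bar.ι]

lemma Bar.decon_single (v : V) : Bar.decon k (Bar.single k v) = 0 := by
  simp [Bar.single, Bar.decon_ι, Bar.deconAux]

lemma Bar.decon_cons (v : V) (y : Bar k V) :
    Bar.decon k (Bar.cons k v y) =
      Bar.single k v ⊗ₜ y + LinearMap.rTensor (Bar k V) (Bar.cons k v) (Bar.decon k y) := by
  induction y using DirectSum.induction_on with
  | zero => simp
  | of n x =>
    change Bar.decon k (Bar.cons k v (Bar.ι k n x)) = Bar.single k v ⊗ₜ (Bar.ι k n x) +
      LinearMap.rTensor (Bar k V) (Bar.cons k v) (Bar.decon k (Bar.ι k n x))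
    rw [Bar.cons_ι, Bar.decon_ι, Bar.decon_ι]
    simp [Bar.deconAux]
  | add a b ha hb => simp only [map_add, ha, hb, TensorProduct.tmul_add]; abel

lemma Bar.coassoc : Coassoc (Bar.decon k (V := V)) := by
  refine LinearMap.ext fun x => ?_
  simp only [LinearMap.comp_apply]
  induction x using Bar.induction with
  | zero => simp
  | add x y hx hy => simp only [map_add, hx, hy]
  | single v => simp [Bar.decon_single]
  | cons v y ih =>
    have h1 : ∀ t : Bar k V ⊗[k] Bar k V,
        LinearMap.rTensor _ (Bar.decon k) (LinearMap.rTensor _ (Bar.cons k v) t) =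
          (TensorProduct.assoc k _ _ _).symm (Bar.single k v ⊗ₜ t) +
          LinearMap.rTensor _ (LinearMap.rTensor _ (Bar.cons k v))
            (LinearMap.rTensor _ (Bar.decon k) t) := by
      intro t
      induction t with
      | zero => simp
      | add a b ha hb => simp only [map_add, ha, hb, TensorProduct.tmul_add]; abel
      | tmul a b => simp [Bar.decon_cons, TensorProduct.add_tmul]
    have h2 : ∀ t : (Bar k V ⊗[k] Bar k V) ⊗[k] Bar k V,
        (TensorProduct.assoc k _ _ _)
          (LinearMap.rTensor _ (LinearMap.rTensor _ (Bar.cons k v)) t) =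
        LinearMap.rTensor _ (Bar.cons k v) (TensorProduct.assoc k _ _ _ t) := by
      intro t
      induction t with
      | zero => simp
      | add a b ha hb => simp only [map_add, ha, hb]
      | tmul a b =>
        induction a with
        | zero => simp
        | add a b ha hb => simp only [map_add, ha, hb, TensorProduct.add_tmul]
        | tmul a b => simp
    have h3 : ∀ t : Bar k V ⊗[k] Bar k V,
        LinearMap.lTensor _ (Bar.decon k) (LinearMap.rTensor _ (Bar.cons k v) t) =
          LinearMap.rTensor _ (Bar.cons k v) (LinearMap.lTensor _ (Bar.decon k) t) := by
      intro t
      rw [← LinearMap.comp_apply, ← LinearMap.comp_apply, LinearMap.lTensor_comp_rTensor,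
        LinearMap.rTensor_comp_lTensor]
    simp only [LinearEquiv.coe_coe] at ih ⊢
    rw [Bar.decon_cons, map_add, map_add, h1, map_add, map_add, h2, ih, h3]
    simp [Bar.decon_single]

lemma Bar.lTensor_decon_eq_zero {X : Type w} [AddCommGroup X] [Module k X] (n : ℕ)
    (T : Bar k V →ₗ[k] X) (hT : ∀ j < n, ∀ y : TPow k V j, T (Bar.ι k j y) = 0)
    (x : TPow k V n) : LinearMap.lTensor (Bar k V) T (Bar.decon k (Bar.ι k n x)) = 0 := by
  induction n with
  | zero => simp [Bar.decon_ι, Bar.deconAux]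
  | succ n ih =>
    obtain ⟨t, rfl⟩ := (TPow.succEquiv k V n).surjective x
    induction t with
    | zero => simp
    | add a b ha hb => simp only [map_add, ha, hb, add_zero]
    | tmul v y =>
      rw [← Bar.cons_ι, Bar.decon_cons, map_add, LinearMap.lTensor_tmul, hT n (by omega),
        TensorProduct.tmul_zero, zero_add, ← LinearMap.comp_apply,
        LinearMap.lTensor_comp_rTensor, ← LinearMap.rTensor_comp_lTensor, LinearMap.comp_apply,
        ih (fun j hj => hT j (by omega)), map_zero]

lemma Bar.iterComul_ι (m n : ℕ) (h : n < m) (x : TPow k V n) :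
    iterComul (Bar.decon k) m (Bar.ι k n x) = 0 := by
  induction m generalizing n with
  | zero => omega
  | succ m ih =>
    simp only [iterComul, LinearMap.comp_apply]
    rw [Bar.lTensor_decon_eq_zero n _ (fun j hj y => ih j (by omega) y), map_zero]

lemma Bar.conilpotent : Conilpotent (Bar.decon k (V := V)) := by
  intro x
  suffices h : ∃ N, ∀ m, N ≤ m → iterComul (Bar.decon k) m x = 0 by
    obtain ⟨N, h⟩ := h; exact ⟨N, h N le_rfl⟩
  induction x using DirectSum.induction_on with
  | zero => exact ⟨0, fun m _ => map_zero _⟩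
  | of n x => exact ⟨n + 1, fun m hm => Bar.iterComul_ι m n (by omega) x⟩
  | add a b ha hb =>
    obtain ⟨N, hN⟩ := ha
    obtain ⟨M, hM⟩ := hb
    exact ⟨max N M, fun m hm => by
      rw [map_add, hN m (by omega), hM m (by omega), add_zero]⟩

end BarFacts

section Restrict

variable {k : Type v} [Field k] {C : Type w} [AddCommGroup C] [Module k C]

lemma mapIncl_injective (M N : Submodule k C) :
    Function.Injective (TensorProduct.mapIncl M N) :=
  TensorProduct.map_injective_of_flat_flat _ _ M.injective_subtype N.injective_subtype

/-- The comultiplication induced on a subspace `E` with `Δ(E) ⊆ E ⊗ E`. -/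
noncomputable def restrictComul (Δ : C →ₗ[k] C ⊗[k] C) (E : Submodule k C)
    (hE : ∀ x ∈ E, Δ x ∈ tensorSub E E) : E →ₗ[k] E ⊗[k] E :=
  (LinearEquiv.ofInjective (TensorProduct.mapIncl E E)
      (mapIncl_injective E E)).symm.toLinearMap ∘ₗ
    (Δ ∘ₗ E.subtype).codRestrict (tensorSub E E) (fun x => hE x x.2)

variable {Δ : C →ₗ[k] C ⊗[k] C} {E : Submodule k C} (hE : ∀ x ∈ E, Δ x ∈ tensorSub E E)

lemma restrictComul_spec (x : E) :
    TensorProduct.map E.subtype E.subtype (restrictComul Δ E hE x) = Δ x := by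
  have := congrArg Subtype.val ((LinearEquiv.ofInjective (TensorProduct.mapIncl E E)
      (mapIncl_injective E E)).apply_symm_apply
      ((Δ ∘ₗ E.subtype).codRestrict (tensorSub E E) (fun x => hE x x.2) x))
  exact this

lemma restrictComul_spec' :
    TensorProduct.map E.subtype E.subtype ∘ₗ restrictComul Δ E hE = Δ ∘ₗ E.subtype :=
  LinearMap.ext (restrictComul_spec hE)

lemma restrictComul_coassoc (h : Coassoc Δ) : Coassoc (restrictComul Δ E hE) := by
  have inj : Function.Injective
      (TensorProduct.map E.subtype (TensorProduct.map E.subtype E.subtype)) :=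
    TensorProduct.map_injective_of_flat_flat _ _ E.injective_subtype (mapIncl_injective E E)
  refine LinearMap.ext fun x => inj ?_
  have h1 : ∀ t : E ⊗[k] E, TensorProduct.map E.subtype (TensorProduct.map E.subtype E.subtype)
      (LinearMap.lTensor E (restrictComul Δ E hE) t) =
      LinearMap.lTensor C Δ (TensorProduct.map E.subtype E.subtype t) := by
    intro t
    induction t with
    | zero => simp
    | add a b ha hb => simp only [map_add, ha, hb]
    | tmul a b => simp [restrictComul_spec]
  have h2 : ∀ t : E ⊗[k] E, TensorProduct.map (TensorProduct.map E.subtype E.subtype) E.subtype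
      (LinearMap.rTensor E (restrictComul Δ E hE) t) =
      LinearMap.rTensor C Δ (TensorProduct.map E.subtype E.subtype t) := by
    intro t
    induction t with
    | zero => simp
    | add a b ha hb => simp only [map_add, ha, hb]
    | tmul a b => simp [restrictComul_spec]
  have h3 : ∀ t : (E ⊗[k] E) ⊗[k] E,
      TensorProduct.map E.subtype (TensorProduct.map E.subtype E.subtype)
        (TensorProduct.assoc k E E E t) =
      TensorProduct.assoc k C C C
        (TensorProduct.map (TensorProduct.map E.subtype E.subtype) E.subtype t) := by
    intro t
    rw [TensorProduct.map_map_assoc]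
  simp only [LinearMap.comp_apply, LinearEquiv.coe_coe]
  rw [h1, h3, h2, restrictComul_spec]
  exact LinearMap.congr_fun h x

lemma restrictComul_conilpotent (h : Conilpotent Δ) : Conilpotent (restrictComul Δ E hE) := by
  have key : ∀ n, ∃ j : TPow k E n →ₗ[k] TPow k C n, Function.Injective j ∧
      ∀ x : E, j (iterComul (restrictComul Δ E hE) n x) = iterComul Δ n x := by
    intro n
    induction n with
    | zero => exact ⟨(TPow.zeroEquiv k C).toLinearMap ∘ₗ E.subtype ∘ₗ
        (TPow.zeroEquiv k E).symm.toLinearMap,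
        (TPow.zeroEquiv k C).injective.comp
          (E.injective_subtype.comp (TPow.zeroEquiv k E).symm.injective), fun x => by simp [iterComul]⟩
    | succ n ih =>
      obtain ⟨j, hj, hjx⟩ := ih
      refine ⟨(TPow.succEquiv k C n).toLinearMap ∘ₗ TensorProduct.map E.subtype j ∘ₗ
        (TPow.succEquiv k E n).symm.toLinearMap, ?_, fun x => ?_⟩
      · simpa using TensorProduct.map_injective_of_flat_flat _ _ E.injective_subtype hj
      · have h1 : ∀ t : E ⊗[k] E, TensorProduct.map E.subtype j
            (LinearMap.lTensor E (iterComul (restrictComul Δ E hE) n) t) =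
            LinearMap.lTensor C (iterComul Δ n) (TensorProduct.map E.subtype E.subtype t) := by
          intro t
          induction t with
          | zero => simp
          | add a b ha hb => simp only [map_add, ha, hb]
          | tmul a b => simp [hjx]
        simp [iterComul, h1, restrictComul_spec]
  intro x
  obtain ⟨n, hn⟩ := h x
  obtain ⟨j, hj, hjx⟩ := key n
  exact ⟨n, hj (by rw [hjx, hn, map_zero])⟩

end Restrict

section Grading

variable {k : Type v} [Field k]

lemma iSupIndep_of_proj {ι V : Type w} [AddCommGroup V] [Module k V] (M : ι → Submodule k V)
    (h : ∀ i, ∃ e : V →ₗ[k] V, (∀ x ∈ M i, e x = x) ∧ ∀ j ≠ i, ∀ x ∈ M j, e x = 0) :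
    iSupIndep M := by
  intro i
  obtain ⟨e, h1, h2⟩ := h i
  rw [Submodule.disjoint_def]
  intro x hx hx'
  have : (⨆ j, ⨆ _ : j ≠ i, M j) ≤ LinearMap.ker e :=
    iSup₂_le fun j hj y hy => h2 j hj y hy
  rw [← h1 x hx]
  exact this hx'

variable {G V : Type w} [AddCommGroup V] [Module k V]

lemma tensorSub_le {M N : Submodule k V} {P : Submodule k (V ⊗[k] V)} :
    tensorSub M N ≤ P ↔ ∀ x ∈ M, ∀ y ∈ N, x ⊗ₜ[k] y ∈ P := by
  rw [tensorSub, TensorProduct.range_mapIncl, Submodule.map₂_le]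
  rfl

lemma tmul_mem_tensorSub {M N : Submodule k V} {x y : V} (hx : x ∈ M) (hy : y ∈ N) :
    x ⊗ₜ[k] y ∈ tensorSub M N :=
  tensorSub_le.1 le_rfl x hx y hy

lemma tensorSub_mono {M N M' N' : Submodule k V} (h : M ≤ M') (h' : N ≤ N') :
    tensorSub M N ≤ tensorSub M' N' :=
  tensorSub_le.2 fun _ hx _ hy => tmul_mem_tensorSub (h hx) (h' hy)

lemma mem_iSup_restrict {ι : Type w} (E : Submodule k V) (P Q : ι → Submodule k V)
    (hP : ∀ i, P i ≤ E) (hQ : ∀ i, Q i ≤ E) (t : E ⊗[k] E)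
    (ht : TensorProduct.map E.subtype E.subtype t ∈ ⨆ i, tensorSub (P i) (Q i)) :
    t ∈ ⨆ i, tensorSub ((P i).comap E.subtype) ((Q i).comap E.subtype) := by
  have h : (⨆ i, tensorSub (P i) (Q i)) ≤
      (⨆ i, tensorSub ((P i).comap E.subtype) ((Q i).comap E.subtype)).map
        (TensorProduct.map E.subtype E.subtype) := by
    refine iSup_le fun i => tensorSub_le.2 fun x hx y hy => ?_
    refine ⟨(⟨x, hP i hx⟩ : E) ⊗ₜ (⟨y, hQ i hy⟩ : E), ?_, by simp⟩
    exact Submodule.mem_iSup_of_mem i (tmul_mem_tensorSub hx hy)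
  obtain ⟨t', ht', e⟩ := h ht
  rwa [← mapIncl_injective E E e]

lemma iSupIndep_restrict {ι : Type w} (E : Submodule k V) {M : ι → Submodule k V}
    (h : iSupIndep M) : iSupIndep fun i => (M i).comap E.subtype := by
  intro i
  rw [Submodule.disjoint_def]
  intro x hx hx'
  apply Subtype.ext
  refine Submodule.disjoint_def.1 (h i) x hx ?_
  have : (⨆ j, ⨆ _ : j ≠ i, (M j).comap E.subtype) ≤ (⨆ j, ⨆ _ : j ≠ i, M j).comap E.subtype :=
    iSup₂_le fun j hj =>
      Submodule.comap_mono (le_iSup₂_of_le (f := fun j _ => M j) j hj le_rfl)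
  exact this hx'

lemma iSup_restrict {ι : Type w} (E : Submodule k V) (M : ι → Submodule k V)
    (h : E = ⨆ i, M i) : (⨆ i, (M i).comap E.subtype) = ⊤ := by
  apply Submodule.map_injective_of_injective E.injective_subtype
  rw [Submodule.map_iSup, Submodule.map_top, Submodule.range_subtype]
  conv_rhs => rw [h]
  refine iSup_congr fun i => ?_
  rw [Submodule.map_comap_subtype, inf_eq_right, h]
  exact le_iSup M i

open Classical in
lemma ColoredSpace.exists_proj (A : ColoredSpace k G V) (f : G → G → Prop) :
    ∃ e : V →ₗ[k] V, ∀ g h, ∀ x ∈ A.piece g h, e x = if f g h then x else 0 := by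
  have hI : DirectSum.IsInternal (fun p : G × G => A.piece p.1 p.2) :=
    (DirectSum.isInternal_submodule_iff_iSupIndep_and_iSup_eq_top _).2 ⟨A.indep, A.sup⟩
  let E := LinearEquiv.ofBijective
    (DirectSum.coeLinearMap (fun p : G × G => A.piece p.1 p.2)) hI
  refine ⟨DirectSum.toModule k (G × G) V
    (fun p => if f p.1 p.2 then (A.piece p.1 p.2).subtype else 0) ∘ₗ E.symm.toLinearMap, ?_⟩
  intro g h x hx
  have : E.symm x = DirectSum.lof k (G × G) (fun p => A.piece p.1 p.2) (g, h) ⟨x, hx⟩ := by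
    rw [LinearEquiv.symm_apply_eq]
    exact (DirectSum.coeLinearMap_lof (fun p : G × G => A.piece p.1 p.2) (g, h) ⟨x, hx⟩).symm
  simp only [LinearMap.comp_apply, LinearEquiv.coe_coe, this, DirectSum.toModule_lof]
  split_ifs <;> simp

lemma ColoredSpace.box_succ_le (A : ColoredSpace k G V) (n : ℕ) (g h : G)
    {P : Submodule k (TPow k V (n + 1))} : A.box (n + 1) g h ≤ P ↔
      ∀ s, ∀ x ∈ A.piece g s, ∀ y ∈ A.box n s h, TPow.succEquiv k V n (x ⊗ₜ y) ∈ P := by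
  rw [ColoredSpace.box, Submodule.map_le_iff_le_comap, iSup_le_iff]
  refine forall_congr' fun s => ?_
  rw [TensorProduct.range_mapIncl, Submodule.map₂_le]
  rfl

lemma ColoredSpace.succ_mem_box (A : ColoredSpace k G V) {n : ℕ} {g s h : G} {x : V}
    {y : TPow k V n} (hx : x ∈ A.piece g s) (hy : y ∈ A.box n s h) :
    TPow.succEquiv k V n (x ⊗ₜ y) ∈ A.box (n + 1) g h :=
  (A.box_succ_le n g h).1 le_rfl s x hx y hy

open Classical in
lemma ColoredSpace.exists_left (A : ColoredSpace k G V) (n : ℕ) (g : G) :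
    ∃ e : TPow k V n →ₗ[k] TPow k V n,
      ∀ a b, ∀ x ∈ A.box n a b, e x = if a = g then x else 0 := by
  obtain ⟨e, he⟩ := A.exists_proj (fun a _ => a = g)
  cases n with
  | zero =>
    refine ⟨(TPow.zeroEquiv k V).toLinearMap ∘ₗ e ∘ₗ (TPow.zeroEquiv k V).symm.toLinearMap, ?_⟩
    rintro a b _ ⟨x, hx, rfl⟩
    simp only [LinearMap.comp_apply, LinearEquiv.coe_coe, LinearEquiv.symm_apply_apply,
      he a b x hx]
    split_ifs <;> simp
  | succ n =>
    refine ⟨(TPow.succEquiv k V n).toLinearMap ∘ₗ LinearMap.rTensor _ e ∘ₗ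
      (TPow.succEquiv k V n).symm.toLinearMap, fun a b => ?_⟩
    suffices h : A.box (n + 1) a b ≤ LinearMap.eqLocus
        ((TPow.succEquiv k V n).toLinearMap ∘ₗ LinearMap.rTensor _ e ∘ₗ
          (TPow.succEquiv k V n).symm.toLinearMap)
        (if a = g then LinearMap.id else 0) by
      intro x hx
      have := h hx
      rw [LinearMap.mem_eqLocus] at this
      rw [this]
      split_ifs <;> rfl
    rw [A.box_succ_le]
    intro s x hx y hy
    rw [LinearMap.mem_eqLocus]
    simp only [LinearMap.comp_apply, LinearEquiv.coe_coe, LinearEquiv.symm_apply_apply,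
      LinearMap.rTensor_tmul, he a s x hx]
    split_ifs <;> simp

open Classical in
lemma ColoredSpace.exists_right (A : ColoredSpace k G V) (n : ℕ) (g : G) :
    ∃ e : TPow k V n →ₗ[k] TPow k V n,
      ∀ a b, ∀ x ∈ A.box n a b, e x = if b = g then x else 0 := by
  induction n with
  | zero =>
    obtain ⟨e, he⟩ := A.exists_proj (fun _ b => b = g)
    refine ⟨(TPow.zeroEquiv k V).toLinearMap ∘ₗ e ∘ₗ (TPow.zeroEquiv k V).symm.toLinearMap, ?_⟩
    rintro a b _ ⟨x, hx, rfl⟩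
    simp only [LinearMap.comp_apply, LinearEquiv.coe_coe, LinearEquiv.symm_apply_apply,
      he a b x hx]
    split_ifs <;> simp
  | succ n ih =>
    obtain ⟨e, he⟩ := ih
    refine ⟨(TPow.succEquiv k V n).toLinearMap ∘ₗ LinearMap.lTensor _ e ∘ₗ
      (TPow.succEquiv k V n).symm.toLinearMap, fun a b => ?_⟩
    suffices h : A.box (n + 1) a b ≤ LinearMap.eqLocus
        ((TPow.succEquiv k V n).toLinearMap ∘ₗ LinearMap.lTensor _ e ∘ₗ
          (TPow.succEquiv k V n).symm.toLinearMap)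
        (if b = g then LinearMap.id else 0) by
      intro x hx
      have := h hx
      rw [LinearMap.mem_eqLocus] at this
      rw [this]
      split_ifs <;> rfl
    rw [A.box_succ_le]
    intro s x hx y hy
    rw [LinearMap.mem_eqLocus]
    simp only [LinearMap.comp_apply, LinearEquiv.coe_coe, LinearEquiv.symm_apply_apply,
      LinearMap.lTensor_tmul, he s b y hy]
    split_ifs <;> simp

open Classical in
lemma ColoredSpace.barPiece_indep (A : ColoredSpace k G V) :
    iSupIndep (fun p : G × G => A.barPiece p.1 p.2) := by
  refine iSupIndep_of_proj _ fun ⟨g, h⟩ => ?_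
  choose l hl using fun n => A.exists_left n g
  choose r hr using fun n => A.exists_right n h
  let e : Bar k V →ₗ[k] Bar k V := DirectSum.toModule k ℕ _ fun n => Bar.ι k n ∘ₗ l n ∘ₗ r n
  have he : ∀ n x, e (Bar.ι k n x) = Bar.ι k n (l n (r n x)) := by
    intro n x
    simp [e, Bar.ι]
  have key : ∀ a b, A.barPiece a b ≤ LinearMap.eqLocus e
      (if a = g ∧ b = h then LinearMap.id else 0) := by
    intro a b
    refine iSup_le fun n => ?_
    rintro _ ⟨x, hx, rfl⟩
    rw [LinearMap.mem_eqLocus, he, hr n a b x hx]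
    by_cases hb : b = h
    · by_cases ha : a = g
      · simp [ha, hb, hl n a b x hx]
      · simp [ha, hb, hl n a b x hx]
    · simp [hb]
  refine ⟨e, fun x hx => ?_, fun ⟨a, b⟩ hab x hx => ?_⟩
  · have := key g h hx
    rw [LinearMap.mem_eqLocus] at this
    simpa using this
  · have := key a b hx
    rw [LinearMap.mem_eqLocus, if_neg (by simpa using hab)] at this
    simpa using this

lemma ColoredSpace.ι_mem_barPiece (A : ColoredSpace k G V) {n : ℕ} {g h : G} {x : TPow k V n}
    (hx : x ∈ A.box n g h) : Bar.ι k n x ∈ A.barPiece g h :=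
  Submodule.mem_iSup_of_mem n ⟨x, hx, rfl⟩

lemma ColoredSpace.single_mem_barPiece (A : ColoredSpace k G V) {g h : G} {x : V}
    (hx : x ∈ A.piece g h) : Bar.single k x ∈ A.barPiece g h :=
  A.ι_mem_barPiece (n := 0) ⟨x, hx, rfl⟩

lemma ColoredSpace.cons_mem_barPiece (A : ColoredSpace k G V) {g s h : G} {x : V} {y : Bar k V}
    (hx : x ∈ A.piece g s) (hy : y ∈ A.barPiece s h) : Bar.cons k x y ∈ A.barPiece g h := by
  suffices H : A.barPiece s h ≤ (A.barPiece g h).comap (Bar.cons k x) from H hy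
  refine iSup_le fun n => ?_
  rintro _ ⟨y, hy, rfl⟩
  rw [Submodule.mem_comap, Bar.cons_ι]
  exact A.ι_mem_barPiece (A.succ_mem_box hx hy)

lemma ColoredSpace.decon_mem (A : ColoredSpace k G V) (g h : G) (x : Bar k V)
    (hx : x ∈ A.barPiece g h) :
    Bar.decon k x ∈ ⨆ s, tensorSub (A.barPiece g s) (A.barPiece s h) := by
  suffices H : ∀ n g h, A.box n g h ≤ (⨆ s, tensorSub (A.barPiece g s) (A.barPiece s h)).comap
      (Bar.decon k ∘ₗ Bar.ι k n) by
    have : A.barPiece g h ≤ (⨆ s, tensorSub (A.barPiece g s) (A.barPiece s h)).comap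
        (Bar.decon k) := by
      refine iSup_le fun n => ?_
      rw [Submodule.map_le_iff_le_comap]
      exact H n g h
    exact this hx
  intro n
  induction n with
  | zero =>
    intro g h x _
    simp [Bar.decon_ι, Bar.deconAux]
  | succ n ih =>
    intro g h
    rw [A.box_succ_le]
    intro s x hx y hy
    rw [Submodule.mem_comap, LinearMap.comp_apply, ← Bar.cons_ι, Bar.decon_cons]
    refine Submodule.add_mem _ ?_ ?_
    · exact Submodule.mem_iSup_of_mem s
        (tmul_mem_tensorSub (A.single_mem_barPiece hx) (A.ι_mem_barPiece hy))
    · have h1 : (⨆ t, tensorSub (A.barPiece s t) (A.barPiece t h)) ≤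
          (⨆ t, tensorSub (A.barPiece g t) (A.barPiece t h)).comap
            (LinearMap.rTensor (Bar k V) (Bar.cons k x)) := by
        refine iSup_le fun t => tensorSub_le.2 fun a ha b hb => ?_
        rw [Submodule.mem_comap, LinearMap.rTensor_tmul]
        exact Submodule.mem_iSup_of_mem t (tmul_mem_tensorSub (A.cons_mem_barPiece hx ha) hb)
      exact h1 (ih s h hy)

lemma ColoredSpace.barPiece_le (A : ColoredSpace k G V) (g h : G) : A.barPiece g h ≤ A.barSub :=
  le_iSup (fun p : G × G => A.barPiece p.1 p.2) (g, h)

lemma ColoredSpace.decon_mem_barSub (A : ColoredSpace k G V) (x : Bar k V) (hx : x ∈ A.barSub) :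
    Bar.decon k x ∈ tensorSub A.barSub A.barSub := by
  suffices H : A.barSub ≤ (tensorSub A.barSub A.barSub).comap (Bar.decon k) from H hx
  refine iSup_le fun p x hx => ?_
  have h1 : (⨆ s, tensorSub (A.barPiece p.1 s) (A.barPiece s p.2)) ≤
      tensorSub A.barSub A.barSub :=
    iSup_le fun s => tensorSub_mono (A.barPiece_le _ _) (A.barPiece_le _ _)
  exact h1 (A.decon_mem _ _ x hx)

/-- The reduced cofree colored coalgebra `⨁_{n > 0} V^{□n}` on a colored vector space `(V, G)`,
with the deconcatenation comultiplication. -/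
noncomputable def ColoredSpace.cofree (A : ColoredSpace k G V) :
    ReducedColoredCoalgebra k G A.barSub where
  piece g h := (A.barPiece g h).comap A.barSub.subtype
  indep := iSupIndep_restrict A.barSub A.barPiece_indep
  sup := iSup_restrict A.barSub _ rfl
  comul := restrictComul (Bar.decon k) A.barSub A.decon_mem_barSub
  coassoc := restrictComul_coassoc _ Bar.coassoc
  conilpotent := restrictComul_conilpotent _ Bar.conilpotent
  comul_piece g h x hx := by
    refine mem_iSup_restrict A.barSub (fun s => A.barPiece g s) (fun s => A.barPiece s h)
      (fun s => A.barPiece_le _ _) (fun s => A.barPiece_le _ _) _ ?_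
    rw [restrictComul_spec]
    exact A.decon_mem g h x hx

/-- The canonical projection from the reduced cofree colored coalgebra on `(V, G)` to `V`. -/
noncomputable def ColoredSpace.cofreeProj (A : ColoredSpace k G V) : A.barSub →ₗ[k] V :=
  Bar.proj k ∘ₗ A.barSub.subtype

end Grading

/-! ### Products of colored vector spaces -/

section Product

variable {k : Type v} [Field k] {ι : Type w} {G V : ι → Type w} [∀ i, AddCommGroup (V i)]
  [∀ i, Module k (V i)]

/-- The underlying space `⨁_{g,h ∈ ∏ Gᵢ} ∏ᵢ ᵍⁱVᵢʰⁱ` of the product of colored vector spaces. -/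
abbrev ColoredProd (A : ∀ i, ColoredSpace k (G i) (V i)) : Type w :=
  ⨁ p : (∀ i, G i) × (∀ i, G i), ∀ i, (A i).piece (p.1 i) (p.2 i)

open Classical in
/-- The product of colored vector spaces, with color set `∏ Gᵢ`. -/
noncomputable def coloredProd (A : ∀ i, ColoredSpace k (G i) (V i)) :
    ColoredSpace k (∀ i, G i) (ColoredProd A) where
  piece g h := LinearMap.range (DirectSum.lof k ((∀ i, G i) × (∀ i, G i))
    (fun p => ∀ i, (A i).piece (p.1 i) (p.2 i)) (g, h))
  indep := by
    refine iSupIndep_of_proj _ fun p => ⟨DirectSum.lof k _ _ p ∘ₗ DirectSum.component k _ _ p,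
      ?_, ?_⟩
    · rintro _ ⟨x, rfl⟩
      simp [DirectSum.component.lof_self]
    · rintro q hq _ ⟨x, rfl⟩
      simp [DirectSum.component.of, hq]
  sup := by
    rw [eq_top_iff]
    rintro x -
    induction x using DirectSum.induction_on with
    | zero => exact Submodule.zero_mem _
    | of p x => exact Submodule.mem_iSup_of_mem p ⟨x, rfl⟩
    | add a b ha hb => exact Submodule.add_mem _ ha hb

open Classical in
/-- The projection of the product of colored vector spaces to the `i`-th factor. -/
noncomputable def coloredProdProj (A : ∀ i, ColoredSpace k (G i) (V i)) (i : ι) :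
    ColoredProd A →ₗ[k] V i :=
  DirectSum.toModule k _ (V i) fun p =>
    ((A i).piece (p.1 i) (p.2 i)).subtype ∘ₗ LinearMap.proj i

end Product

namespace RedColCoalg

variable {k : Type v} [Field k] {ι : Type w} (X : ι → RedColCoalg.{w, v} k)

/-- The reduced cofree colored coalgebra on the product of the colored vector spaces underlying
a family `X` of reduced colored coalgebras. -/
noncomputable abbrev cofreeProd : RedColCoalg.{w, v} k :=
  of (coloredProd fun i => (X i).str.toColoredSpace).cofree

/-- The composite linear map from the reduced cofree colored coalgebra on the product of the
colored vector spaces `Xᵢ`, through that product, to `Xᵢ`. -/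
noncomputable def cofreeProdProj (i : ι) : (cofreeProd X).carrier →ₗ[k] (X i).carrier :=
  coloredProdProj (fun i => (X i).str.toColoredSpace) i ∘ₗ
    (coloredProd fun i => (X i).str.toColoredSpace).cofreeProj

/-- A subcoalgebra `E` of the cofree object is compatible with the projections if every composite
`E → Xᵢ` preserves the comultiplication. -/
structure IsCompatible (E : Submodule k (cofreeProd X).carrier) : Prop where
  isSubcoalgebra : (cofreeProd X).IsSubcoalgebra E
  comul_proj : ∀ i, ∀ x ∈ E, TensorProduct.map (cofreeProdProj X i) (cofreeProdProj X i)
    ((cofreeProd X).comul x) = (X i).comul (cofreeProdProj X i x)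

/-- The sum of all subcoalgebras of the cofree object compatible with the projections. -/
noncomputable def prodSub : Submodule k (cofreeProd X).carrier :=
  sSup {E | IsCompatible X E}

variable {X} {C D : RedColCoalg.{w, v} k}

/-- The colors of the coequalizer of `f, g : C ⟶ D`: the quotient of the colors of `D` by the
equivalence relation generated by `f(x) ∼ g(x)` for the colors `x` of `C`. -/
abbrev CoeqColor (f g : C ⟶ D) : Type w :=
  Quot fun s t : D.Color => ∃ x : C.Color, s = f.color x ∧ t = g.color x

/-- The space `D / Im(f - g)`. -/
abbrev CoeqSpace (f g : C ⟶ D) : Type w :=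
  D.carrier ⧸ LinearMap.range (f.lin - g.lin)

/-- The bigrading of `D` by the quotient color set: `^[s]D^[t]` is the sum of all `ᵃDᵇ` with
`a ∈ [s]` and `b ∈ [t]`. -/
def coarsePiece (f g : C ⟶ D) (s t : CoeqColor f g) : Submodule k D.carrier :=
  ⨆ (a : D.Color) (b : D.Color) (_ : Quot.mk _ a = s) (_ : Quot.mk _ b = t), D.piece a b

end RedColCoalg

end RedCol

/-!
Coequalizers. The image of `f - g` is a coideal: the quotient map `q : D → D / Im(f - g)` satisfies
`q f = q g`, so `q ⊗ q` kills `Δ(f x - g x) = (f ⊗ f - g ⊗ g)(Δ x)`. The image is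
homogeneous for the bigrading of `D` by the coarsened color set, since `f` and `g` send a given
piece of `C` into the same coarse piece of `D`. So `D / Im(f - g)` inherits all the structure
(`coeqStr`; conilpotency passes to quotients by `Conilpotent.of_surjective`), and its universal
property is that of a quotient of vector spaces together with that of a quotient of sets.

Products. The reduced cofree coalgebra on `V` has the universal property that a bigraded linear map
`φ : C → V` lifts uniquely to a morphism `F`. The component of `F` in `V^{⊗(n+1)}` has to be
`φ^{⊗(n+1)} ∘ Δⁿ`, because the components of a bar are recovered by iterating the deconcatenation
(`Bar.comp_succ_eq`). Conversely these components define a map into the direct sum, since `C` is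
conilpotent (`Bar.exists_linearMap_comp`), and it is comultiplicative, since `C` is coassociative
(`Bar.comul_of_comp`). A family of morphisms `fᵢ : Y → Xᵢ` yields a bigraded linear map from `Y` to
the product of the colored vector spaces, hence a morphism from `Y` to the cofree object. The image
of this morphism is a subcoalgebra, and it is compatible with the projections because each `fᵢ` is
comultiplicative; so the morphism factors through the largest compatible subcoalgebra
(`exists_prodLift`). Uniqueness follows from the uniqueness of lifts. A subcoalgebra of a colored
coalgebra is itself a colored coalgebra: one has to see that the comultiplication of a homogeneous
element of `E` involves only homogeneous tensors inside `E ⊗ E` (`IsSubcoalgebra.comul_mem_iSup`).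
-/

namespace RedCol

/-! ### Tensor powers of linear maps and iterated comultiplications -/

section TensorPower

variable {k : Type v} [Field k] {C D V W : Type w} [AddCommGroup C] [Module k C]
  [AddCommGroup D] [Module k D] [AddCommGroup V] [Module k V] [AddCommGroup W] [Module k W]

/-- The tensor power `φ ⊗ ⋯ ⊗ φ`, with `n + 1` factors, of a linear map `φ`. -/
noncomputable def TPow.map (φ : V →ₗ[k] W) : (n : ℕ) → TPow k V n →ₗ[k] TPow k W n
  | 0 => (TPow.zeroEquiv k W).toLinearMap ∘ₗ φ ∘ₗ (TPow.zeroEquiv k V).symm.toLinearMap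
  | n + 1 => (TPow.succEquiv k W n).toLinearMap ∘ₗ TensorProduct.map φ (TPow.map φ n) ∘ₗ
      (TPow.succEquiv k V n).symm.toLinearMap

lemma TPow.map_zero_iterComul (φ : C →ₗ[k] V) (Δ : C →ₗ[k] C ⊗[k] C) (x : C) :
    TPow.map φ 0 (iterComul Δ 0 x) = TPow.zeroEquiv k V (φ x) := by
  simp [TPow.map, iterComul]

lemma TPow.map_succ_iterComul (φ : C →ₗ[k] V) (Δ : C →ₗ[k] C ⊗[k] C) (n : ℕ) (x : C) :
    TPow.map φ (n + 1) (iterComul Δ (n + 1) x) = TPow.succEquiv k V n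
      (TensorProduct.map φ (TPow.map φ n ∘ₗ iterComul Δ n) (Δ x)) := by
  simp only [TPow.map, iterComul, LinearMap.comp_apply, LinearEquiv.coe_coe,
    LinearEquiv.symm_apply_apply]
  rw [← LinearMap.comp_apply (TensorProduct.map φ (TPow.map φ n)), LinearMap.map_comp_lTensor]

lemma TPow.map_iterComul_of_comp {Δ : C →ₗ[k] C ⊗[k] C} {Δ' : D →ₗ[k] D ⊗[k] D} {f : C →ₗ[k] D}
    (hf : TensorProduct.map f f ∘ₗ Δ = Δ' ∘ₗ f) (n : ℕ) (x : C) :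
    TPow.map f n (iterComul Δ n x) = iterComul Δ' n (f x) := by
  induction n generalizing x with
  | zero => exact TPow.map_zero_iterComul f Δ x
  | succ n ih =>
    have h : TPow.map f n ∘ₗ iterComul Δ n = iterComul Δ' n ∘ₗ f := LinearMap.ext ih
    rw [TPow.map_succ_iterComul, h, ← LinearMap.lTensor_comp_map, LinearMap.comp_apply,
      ← LinearMap.comp_apply (TensorProduct.map f f), hf]
    rfl

lemma Conilpotent.of_surjective {Δ : C →ₗ[k] C ⊗[k] C} {Δ' : D →ₗ[k] D ⊗[k] D} {f : C →ₗ[k] D}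
    (hΔ : Conilpotent Δ) (hf : TensorProduct.map f f ∘ₗ Δ = Δ' ∘ₗ f)
    (hs : Function.Surjective f) : Conilpotent Δ' := by
  intro y
  obtain ⟨x, rfl⟩ := hs y
  obtain ⟨n, hn⟩ := hΔ x
  exact ⟨n, by rw [← TPow.map_iterComul_of_comp hf, hn, map_zero]⟩

lemma Coassoc.of_surjective {Δ : C →ₗ[k] C ⊗[k] C} {Δ' : D →ₗ[k] D ⊗[k] D} {f : C →ₗ[k] D}
    (hΔ : Coassoc Δ) (hf : TensorProduct.map f f ∘ₗ Δ = Δ' ∘ₗ f)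
    (hs : Function.Surjective f) : Coassoc Δ' := by
  refine LinearMap.ext fun y => ?_
  obtain ⟨x, rfl⟩ := hs y
  have hf' := LinearMap.congr_fun hf x
  simp only [LinearMap.comp_apply] at hf'
  have h1 : ∀ t : C ⊗[k] C, LinearMap.rTensor D Δ' (TensorProduct.map f f t) =
      TensorProduct.map (TensorProduct.map f f) f (LinearMap.rTensor C Δ t) := fun t => by
    rw [← LinearMap.comp_apply, ← LinearMap.comp_apply, LinearMap.rTensor_comp_map, ← hf,
      LinearMap.map_comp_rTensor]
  have h2 : ∀ t : C ⊗[k] C, LinearMap.lTensor D Δ' (TensorProduct.map f f t) =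
      TensorProduct.map f (TensorProduct.map f f) (LinearMap.lTensor C Δ t) := fun t => by
    rw [← LinearMap.comp_apply, ← LinearMap.comp_apply, LinearMap.lTensor_comp_map, ← hf,
      LinearMap.map_comp_lTensor]
  simp only [LinearMap.comp_apply, LinearEquiv.coe_coe]
  rw [← hf', h1, h2, ← TensorProduct.map_map_assoc]
  exact congrArg _ (LinearMap.congr_fun hΔ x)

lemma exists_iterComul_succ (Δ : C →ₗ[k] C ⊗[k] C) (n : ℕ) :
    ∃ S : TPow k C n →ₗ[k] TPow k C (n + 1), iterComul Δ (n + 1) = S ∘ₗ iterComul Δ n := by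
  induction n with
  | zero =>
    exact ⟨iterComul Δ 1 ∘ₗ (TPow.zeroEquiv k C).symm.toLinearMap,
      LinearMap.ext fun x => by simp [iterComul]⟩
  | succ n ih =>
    obtain ⟨S, hS⟩ := ih
    refine ⟨(TPow.succEquiv k C (n + 1)).toLinearMap ∘ₗ LinearMap.lTensor C S ∘ₗ
      (TPow.succEquiv k C n).symm.toLinearMap, LinearMap.ext fun x => ?_⟩
    change TPow.succEquiv k C (n + 1) (LinearMap.lTensor C (iterComul Δ (n + 1)) (Δ x)) =
      TPow.succEquiv k C (n + 1) (LinearMap.lTensor C S ((TPow.succEquiv k C n).symm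
        (TPow.succEquiv k C n (LinearMap.lTensor C (iterComul Δ n) (Δ x)))))
    rw [LinearEquiv.symm_apply_apply, hS, LinearMap.lTensor_comp_apply]

lemma iterComul_eq_zero_of_le {Δ : C →ₗ[k] C ⊗[k] C} {x : C} {m n : ℕ} (h : m ≤ n)
    (hx : iterComul Δ m x = 0) : iterComul Δ n x = 0 := by
  induction n, h using Nat.le_induction with
  | base => exact hx
  | succ n _ ih =>
    obtain ⟨S, hS⟩ := exists_iterComul_succ Δ n
    rw [hS, LinearMap.comp_apply, ih, map_zero]

end TensorPower

/-! ### The components of the reduced tensor coalgebra -/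

section Components

variable {k : Type v} [Field k] {C V : Type w} [AddCommGroup C] [Module k C]
  [AddCommGroup V] [Module k V]

variable (k V) in
/-- The projection of the reduced tensor coalgebra onto `V^{⊗(n+1)}`. -/
noncomputable def Bar.comp (n : ℕ) : Bar k V →ₗ[k] TPow k V n :=
  DirectSum.component k ℕ (fun n => TPow k V n) n

lemma Bar.comp_ι_self (n : ℕ) (x : TPow k V n) : Bar.comp k V n (Bar.ι k n x) = x := by
  simp [Bar.comp, Bar.ι, DirectSum.component.lof_self]

lemma Bar.comp_ι_of_ne {m n : ℕ} (h : m ≠ n) (x : TPow k V m) :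
    Bar.comp k V n (Bar.ι k m x) = 0 := by
  simp [Bar.comp, Bar.ι, DirectSum.component.of, h]

lemma Bar.comp_zero (x : Bar k V) : Bar.comp k V 0 x = TPow.zeroEquiv k V (Bar.proj k x) := by
  simp [Bar.comp, Bar.proj]

lemma Bar.proj_single (v : V) : Bar.proj k (Bar.single k v) = v := by
  apply (TPow.zeroEquiv k V).injective
  rw [← Bar.comp_zero]
  exact Bar.comp_ι_self 0 _

lemma Bar.comp_succ_single (n : ℕ) (v : V) : Bar.comp k V (n + 1) (Bar.single k v) = 0 :=
  Bar.comp_ι_of_ne (by omega) _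

lemma Bar.ext_comp {x y : Bar k V} (h : ∀ n, Bar.comp k V n x = Bar.comp k V n y) : x = y :=
  DFinsupp.ext h

lemma Bar.proj_cons (v : V) (y : Bar k V) : Bar.proj k (Bar.cons k v y) = 0 := by
  apply (TPow.zeroEquiv k V).injective
  rw [← Bar.comp_zero, map_zero]
  induction y using DirectSum.induction_on with
  | zero => simp
  | add a b ha hb => rw [map_add, map_add, ha, hb, add_zero]
  | of n x =>
    change Bar.comp k V 0 (Bar.cons k v (Bar.ι k n x)) = 0
    rw [Bar.cons_ι, Bar.comp_ι_of_ne (by omega)]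

lemma Bar.comp_succ_cons (n : ℕ) (v : V) (y : Bar k V) :
    Bar.comp k V (n + 1) (Bar.cons k v y) = TPow.succEquiv k V n (v ⊗ₜ Bar.comp k V n y) := by
  induction y using DirectSum.induction_on with
  | zero => simp
  | add a b ha hb => simp only [map_add, ha, hb, TensorProduct.tmul_add]
  | of m x =>
    change Bar.comp k V (n + 1) (Bar.cons k v (Bar.ι k m x)) =
      TPow.succEquiv k V n (v ⊗ₜ Bar.comp k V n (Bar.ι k m x))
    rw [Bar.cons_ι]
    obtain rfl | h := eq_or_ne m n
    · rw [Bar.comp_ι_self, Bar.comp_ι_self]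
    · rw [Bar.comp_ι_of_ne (by omega), Bar.comp_ι_of_ne h, TensorProduct.tmul_zero, map_zero]

/-- Every component of length at least two is recovered from deconcatenation by splitting off
the first letter. This makes a comultiplicative map into `Bar k V` determined by its component
of length one. -/
lemma Bar.comp_succ_eq (n : ℕ) (x : Bar k V) :
    Bar.comp k V (n + 1) x = TPow.succEquiv k V n
      (TensorProduct.map (Bar.proj k) (Bar.comp k V n) (Bar.decon k x)) := by
  induction x using Bar.induction with
  | zero => simp
  | add x y hx hy => simp only [map_add, hx, hy]
  | single v => rw [Bar.decon_single, Bar.comp_succ_single, map_zero, map_zero]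
  | cons v y _ =>
    have h : Bar.proj k ∘ₗ Bar.cons k v = 0 := LinearMap.ext (Bar.proj_cons v)
    rw [Bar.comp_succ_cons, Bar.decon_cons, map_add, TensorProduct.map_tmul, Bar.proj_single,
      ← LinearMap.comp_apply (TensorProduct.map _ _), LinearMap.map_comp_rTensor, h,
      TensorProduct.map_zero_left, LinearMap.zero_apply, add_zero]

lemma Bar.eq_zero_of_rTensor_comp {W : Type w} [AddCommGroup W] [Module k W]
    {t : Bar k V ⊗[k] W} (h : ∀ n, LinearMap.rTensor W (Bar.comp k V n) t = 0) : t = 0 := by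
  -- an element of `Bar k V ⊗ W` involves only finitely many tensor lengths
  have key : ∃ s : Finset ℕ, ∀ s', s ⊆ s' →
      t = ∑ n ∈ s', LinearMap.rTensor W (Bar.ι k n) (LinearMap.rTensor W (Bar.comp k V n) t) := by
    clear h
    induction t with
    | zero => exact ⟨∅, fun s' _ => by simp⟩
    | add a b ha hb =>
      obtain ⟨s, hs⟩ := ha
      obtain ⟨r, hr⟩ := hb
      refine ⟨s ∪ r, fun s' h' => ?_⟩
      simp only [map_add, Finset.sum_add_distrib]
      rw [← hs s' (Finset.union_subset_left h'), ← hr s' (Finset.union_subset_right h')]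
    | tmul x y =>
      induction x using DirectSum.induction_on with
      | zero => exact ⟨∅, fun s' _ => by simp⟩
      | add a b ha hb =>
        obtain ⟨s, hs⟩ := ha
        obtain ⟨r, hr⟩ := hb
        refine ⟨s ∪ r, fun s' h' => ?_⟩
        simp only [TensorProduct.add_tmul, map_add, Finset.sum_add_distrib]
        rw [← hs s' (Finset.union_subset_left h'), ← hr s' (Finset.union_subset_right h')]
      | of m x =>
        refine ⟨{m}, fun s' h' => ?_⟩
        change Bar.ι k m x ⊗ₜ[k] y = ∑ n ∈ s', LinearMap.rTensor W (Bar.ι k n)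
          (LinearMap.rTensor W (Bar.comp k V n) (Bar.ι k m x ⊗ₜ[k] y))
        rw [Finset.sum_eq_single_of_mem m (h' (Finset.mem_singleton_self m))]
        · simp [Bar.comp_ι_self]
        · intro n _ hn
          simp [Bar.comp_ι_of_ne hn.symm]
  obtain ⟨s, hs⟩ := key
  rw [hs s subset_rfl]
  exact Finset.sum_eq_zero fun n _ => by rw [h, map_zero]

end Components

/-! ### The universal property of the reduced cofree colored coalgebra -/

section Lift

variable {k : Type v} [Field k] {C V : Type w} [AddCommGroup C] [Module k C]
  [AddCommGroup V] [Module k V]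

lemma Bar.comp_eq_of_comul {Δ : C →ₗ[k] C ⊗[k] C} {F : C →ₗ[k] Bar k V}
    (hF : TensorProduct.map F F ∘ₗ Δ = Bar.decon k ∘ₗ F) (n : ℕ) (x : C) :
    Bar.comp k V n (F x) = TPow.map (Bar.proj k ∘ₗ F) n (iterComul Δ n x) := by
  induction n generalizing x with
  | zero => rw [TPow.map_zero_iterComul, Bar.comp_zero, LinearMap.comp_apply]
  | succ n ih =>
    have h : TPow.map (Bar.proj k ∘ₗ F) n ∘ₗ iterComul Δ n = Bar.comp k V n ∘ₗ F :=
      LinearMap.ext fun x => (ih x).symm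
    rw [TPow.map_succ_iterComul, h, TensorProduct.map_comp, Bar.comp_succ_eq,
      ← LinearMap.comp_apply (Bar.decon k), ← hF]
    rfl

/-- A comultiplicative map into the reduced tensor coalgebra is determined by its projection to
the bars of length one. -/
lemma Bar.comul_hom_ext {Δ : C →ₗ[k] C ⊗[k] C} {F F' : C →ₗ[k] Bar k V}
    (hF : TensorProduct.map F F ∘ₗ Δ = Bar.decon k ∘ₗ F)
    (hF' : TensorProduct.map F' F' ∘ₗ Δ = Bar.decon k ∘ₗ F')
    (h : Bar.proj k ∘ₗ F = Bar.proj k ∘ₗ F') : F = F' :=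
  LinearMap.ext fun x => Bar.ext_comp fun n => by
    rw [Bar.comp_eq_of_comul hF, Bar.comp_eq_of_comul hF', h]

/-- Conilpotency makes the family of components `φ^{⊗(n+1)} ∘ Δⁿ` pointwise finitely supported, so
that it defines a map into the direct sum. -/
lemma Bar.exists_linearMap_comp {Δ : C →ₗ[k] C ⊗[k] C} (hΔ : Conilpotent Δ) (φ : C →ₗ[k] V) :
    ∃ F : C →ₗ[k] Bar k V, ∀ n x, Bar.comp k V n (F x) = TPow.map φ n (iterComul Δ n x) := by
  have key : ∀ x, ∃ y : Bar k V, ∀ n, Bar.comp k V n y = TPow.map φ n (iterComul Δ n x) := by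
    intro x
    obtain ⟨N, hN⟩ := hΔ x
    refine ⟨∑ m ∈ Finset.range N, Bar.ι k m (TPow.map φ m (iterComul Δ m x)), fun n => ?_⟩
    rw [map_sum]
    by_cases hn : n < N
    · rw [Finset.sum_eq_single_of_mem n (Finset.mem_range.2 hn) fun m _ hm =>
        Bar.comp_ι_of_ne hm _, Bar.comp_ι_self]
    · rw [iterComul_eq_zero_of_le (not_lt.1 hn) hN, map_zero]
      refine Finset.sum_eq_zero fun m hm => Bar.comp_ι_of_ne ?_ _
      rw [Finset.mem_range] at hm
      omega
  choose F hF using key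
  exact ⟨{ toFun := F
           map_add' := fun x y => Bar.ext_comp fun n => by simp only [map_add, hF]
           map_smul' := fun c x => Bar.ext_comp fun n => by
             simp only [map_smul, hF, RingHom.id_apply] }, fun n x => hF x n⟩

/-- The map with components `φ^{⊗(n+1)} ∘ Δⁿ` is comultiplicative. After projecting the first factor
of `Bar k V ⊗ Bar k V` to length `n + 1`, both sides are `(φ^{⊗(n+1)} ∘ Δⁿ) ⊗ F` applied to `Δ x`;
this goes by induction on `n`, with coassociativity in the inductive step. -/
lemma Bar.comul_of_comp {Δ : C →ₗ[k] C ⊗[k] C} (hΔ : Coassoc Δ) {φ : C →ₗ[k] V}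
    {F : C →ₗ[k] Bar k V}
    (hF : ∀ n x, Bar.comp k V n (F x) = TPow.map φ n (iterComul Δ n x)) :
    TensorProduct.map F F ∘ₗ Δ = Bar.decon k ∘ₗ F := by
  let μ : V ⊗[k] Bar k V →ₗ[k] Bar k V := TensorProduct.lift (Bar.cons k)
  -- the recursion `F = [φ] + cons ∘ (φ ⊗ F) ∘ Δ`
  have hrec : ∀ x, F x = Bar.single k (φ x) + μ (TensorProduct.map φ F (Δ x)) := by
    intro x
    refine Bar.ext_comp fun n => ?_
    cases n with
    | zero =>
      have h0 : Bar.comp k V 0 ∘ₗ μ = 0 := TensorProduct.ext' fun v y => by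
        simp [μ, Bar.comp_zero, Bar.proj_cons]
      rw [hF, TPow.map_zero_iterComul, map_add, ← LinearMap.comp_apply (Bar.comp k V 0) μ, h0,
        Bar.comp_zero, Bar.proj_single, LinearMap.zero_apply, add_zero]
    | succ n =>
      have h1 : Bar.comp k V (n + 1) ∘ₗ μ =
          (TPow.succEquiv k V n).toLinearMap ∘ₗ LinearMap.lTensor V (Bar.comp k V n) :=
        TensorProduct.ext' fun v y => by simp [μ, Bar.comp_succ_cons]
      have h2 : TPow.map φ n ∘ₗ iterComul Δ n = Bar.comp k V n ∘ₗ F :=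
        LinearMap.ext fun x => (hF n x).symm
      rw [hF, TPow.map_succ_iterComul, map_add, Bar.comp_succ_single, zero_add,
        ← LinearMap.comp_apply (Bar.comp k V (n + 1)) μ, h1, h2, ← LinearMap.lTensor_comp_map]
      rfl
  have hdecon : ∀ x, Bar.decon k (F x) = TensorProduct.map (Bar.single k ∘ₗ φ) F (Δ x) +
      TensorProduct.lift (LinearMap.rTensorHom (Bar k V) ∘ₗ Bar.cons k)
        (TensorProduct.map φ (Bar.decon k ∘ₗ F) (Δ x)) := by
    intro x
    have h1 : ∀ t : C ⊗[k] C, Bar.decon k (μ (TensorProduct.map φ F t)) =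
        TensorProduct.map (Bar.single k ∘ₗ φ) F t +
        TensorProduct.lift (LinearMap.rTensorHom (Bar k V) ∘ₗ Bar.cons k)
          (TensorProduct.map φ (Bar.decon k ∘ₗ F) t) := by
      intro t
      induction t with
      | zero => simp
      | add a b ha hb => simp only [map_add, ha, hb]; abel
      | tmul a b => simp [μ, Bar.decon_cons]
    rw [← h1, hrec, map_add, Bar.decon_single, zero_add]
  have key : ∀ n x, LinearMap.rTensor (Bar k V) (Bar.comp k V n) (Bar.decon k (F x)) =
      TensorProduct.map (TPow.map φ n ∘ₗ iterComul Δ n) F (Δ x) := by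
    intro n
    induction n with
    | zero =>
      intro x
      rw [hdecon, map_add]
      have h1 : ∀ t, LinearMap.rTensor (Bar k V) (Bar.comp k V 0)
          (TensorProduct.lift (LinearMap.rTensorHom (Bar k V) ∘ₗ Bar.cons k) t) = 0 := by
        intro t
        induction t with
        | zero => simp
        | add a b ha hb => simp only [map_add, ha, hb, add_zero]
        | tmul v z =>
          have : Bar.comp k V 0 ∘ₗ Bar.cons k v = 0 := LinearMap.ext fun y => by
            simp [Bar.comp_zero, Bar.proj_cons]
          simp [← LinearMap.rTensor_comp_apply, this]
      rw [h1, add_zero, ← LinearMap.comp_apply, LinearMap.rTensor_comp_map]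
      congr 2
    | succ n ih =>
      intro x
      have ih' : LinearMap.rTensor (Bar k V) (Bar.comp k V n) ∘ₗ Bar.decon k ∘ₗ F =
          TensorProduct.map (TPow.map φ n ∘ₗ iterComul Δ n) F ∘ₗ Δ := LinearMap.ext ih
      have h0 : Bar.comp k V (n + 1) ∘ₗ Bar.single k = 0 :=
        LinearMap.ext (Bar.comp_succ_single n)
      -- prepending a letter, then projecting to length `n + 2`
      have h1 : ∀ t, LinearMap.rTensor (Bar k V) (Bar.comp k V (n + 1))
          (TensorProduct.lift (LinearMap.rTensorHom (Bar k V) ∘ₗ Bar.cons k) t) =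
          LinearMap.rTensor (Bar k V) (TPow.succEquiv k V n).toLinearMap
            ((TensorProduct.assoc k _ _ _).symm
              (LinearMap.lTensor V (LinearMap.rTensor (Bar k V) (Bar.comp k V n)) t)) := by
        intro t
        induction t with
        | zero => simp
        | add a b ha hb => simp only [map_add, ha, hb]
        | tmul v z =>
          induction z with
          | zero => simp
          | add a b ha hb => simp only [TensorProduct.tmul_add, map_add, ha, hb]
          | tmul a b => simp [Bar.comp_succ_cons]
      have h2 : ∀ t : C ⊗[k] (C ⊗[k] C), LinearMap.rTensor (Bar k V)
          (TPow.succEquiv k V n).toLinearMap ((TensorProduct.assoc k _ _ _).symm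
            (TensorProduct.map φ (TensorProduct.map (TPow.map φ n ∘ₗ iterComul Δ n) F) t)) =
          TensorProduct.map ((TPow.succEquiv k V n).toLinearMap ∘ₗ
            TensorProduct.map φ (TPow.map φ n ∘ₗ iterComul Δ n)) F
              ((TensorProduct.assoc k _ _ _).symm t) := by
        intro t
        induction t with
        | zero => simp
        | add a b ha hb => simp only [map_add, ha, hb]
        | tmul v z =>
          induction z with
          | zero => simp
          | add a b ha hb => simp only [TensorProduct.tmul_add, map_add, ha, hb]
          | tmul a b => simp
      have h3 : TPow.map φ (n + 1) ∘ₗ iterComul Δ (n + 1) = ((TPow.succEquiv k V n).toLinearMap ∘ₗ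
            TensorProduct.map φ (TPow.map φ n ∘ₗ iterComul Δ n)) ∘ₗ Δ :=
        LinearMap.ext fun y => TPow.map_succ_iterComul φ Δ n y
      have h4 : (TensorProduct.assoc k _ _ _).symm (LinearMap.lTensor C Δ (Δ x)) =
          LinearMap.rTensor C Δ (Δ x) := by
        rw [LinearEquiv.symm_apply_eq]
        exact (LinearMap.congr_fun hΔ x).symm
      rw [hdecon, map_add, ← LinearMap.comp_apply (LinearMap.rTensor _ _) (TensorProduct.map _ _),
        LinearMap.rTensor_comp_map, ← LinearMap.comp_assoc, h0, LinearMap.zero_comp,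
        TensorProduct.map_zero_left, LinearMap.zero_apply, zero_add, h1,
        ← LinearMap.comp_apply (LinearMap.lTensor _ _), LinearMap.lTensor_comp_map, ih',
        ← LinearMap.map_comp_lTensor, LinearMap.comp_apply, h2, h4,
        ← LinearMap.comp_apply (TensorProduct.map _ _), LinearMap.map_comp_rTensor, h3]
  refine LinearMap.ext fun x => sub_eq_zero.1 (Bar.eq_zero_of_rTensor_comp fun n => ?_)
  have h : Bar.comp k V n ∘ₗ F = TPow.map φ n ∘ₗ iterComul Δ n := LinearMap.ext (hF n)
  rw [map_sub, LinearMap.comp_apply, LinearMap.comp_apply, key, sub_eq_zero,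
    ← LinearMap.comp_apply (LinearMap.rTensor _ _), LinearMap.rTensor_comp_map, h]

variable {G H : Type w}

lemma ReducedColoredCoalgebra.map_iterComul_mem_box (Y : ReducedColoredCoalgebra k G C)
    (A : ColoredSpace k H V) (c : G → H) {φ : C →ₗ[k] V}
    (hφ : ∀ a b, ∀ x ∈ Y.piece a b, φ x ∈ A.piece (c a) (c b)) (n : ℕ) (a b : G) (x : C)
    (hx : x ∈ Y.piece a b) : TPow.map φ n (iterComul Y.comul n x) ∈ A.box n (c a) (c b) := by
  induction n generalizing a b x with
  | zero =>
    rw [TPow.map_zero_iterComul]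
    exact ⟨_, hφ a b x hx, rfl⟩
  | succ n ih =>
    rw [TPow.map_succ_iterComul]
    have h : (⨆ s, tensorSub (Y.piece a s) (Y.piece s b)) ≤ (A.box (n + 1) (c a) (c b)).comap
        ((TPow.succEquiv k V n).toLinearMap ∘ₗ
          TensorProduct.map φ (TPow.map φ n ∘ₗ iterComul Y.comul n)) :=
      iSup_le fun s => tensorSub_le.2 fun y hy z hz =>
        A.succ_mem_box (hφ a s y hy) (ih s b z hz)
    exact h (Y.comul_piece a b x hx)

lemma ColoredSpace.mem_barPiece_of_comp (A : ColoredSpace k H V) {g h : H} {x : Bar k V}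
    (hx : ∀ n, Bar.comp k V n x ∈ A.box n g h) : x ∈ A.barPiece g h := by
  classical
  have hs : x = ∑ n ∈ DFinsupp.support x, Bar.ι k n (Bar.comp k V n x) :=
    (DirectSum.sum_support_of x).symm
  rw [hs]
  exact Submodule.sum_mem _ fun n _ => A.ι_mem_barPiece (hx n)

lemma ColoredSpace.proj_mem_piece (A : ColoredSpace k H V) {g h : H} {x : Bar k V}
    (hx : x ∈ A.barPiece g h) : Bar.proj k x ∈ A.piece g h := by
  suffices H : A.barPiece g h ≤ (A.piece g h).comap (Bar.proj k) from H hx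
  refine iSup_le fun n => ?_
  rintro _ ⟨y, hy, rfl⟩
  rw [Submodule.mem_comap]
  cases n with
  | zero =>
    obtain ⟨v, hv, rfl⟩ := hy
    change Bar.proj k (Bar.single k v) ∈ _
    rwa [Bar.proj_single]
  | succ n =>
    have : Bar.proj k (Bar.ι k (n + 1) y) = 0 := by
      apply (TPow.zeroEquiv k V).injective
      rw [← Bar.comp_zero, Bar.comp_ι_of_ne (by omega), map_zero]
    rw [this]
    exact Submodule.zero_mem _

/-- A map that preserves the bigradings into `V` lifts to a morphism into the reduced cofree
colored coalgebra on `V`. -/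
lemma ColoredSpace.exists_cofree_lift (Y : ReducedColoredCoalgebra k G C)
    (A : ColoredSpace k H V) (c : G → H) (φ : C →ₗ[k] V)
    (hφ : ∀ a b, ∀ x ∈ Y.piece a b, φ x ∈ A.piece (c a) (c b)) :
    ∃ F : RedColCoalg.of Y ⟶ RedColCoalg.of A.cofree,
      F.color = c ∧ A.cofreeProj ∘ₗ F.lin = φ := by
  obtain ⟨F, hF⟩ := Bar.exists_linearMap_comp Y.conilpotent φ
  have hpiece : ∀ a b, ∀ x ∈ Y.piece a b, F x ∈ A.barPiece (c a) (c b) := fun a b x hx =>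
    A.mem_barPiece_of_comp fun n => by
      rw [hF]; exact Y.map_iterComul_mem_box A c hφ n a b x hx
  have hsub : ∀ x, F x ∈ A.barSub := by
    have : (⊤ : Submodule k C) ≤ A.barSub.comap F := by
      rw [← Y.sup]
      exact iSup_le fun p x hx => A.barPiece_le _ _ (hpiece p.1 p.2 x hx)
    exact fun x => this trivial
  refine ⟨
    { color := c
      lin := F.codRestrict A.barSub hsub
      map_piece := hpiece
      map_comul := ?_ }, rfl, LinearMap.ext fun x => ?_⟩
  · refine LinearMap.ext fun x => mapIncl_injective _ _ ?_
    refine Eq.trans ?_ (restrictComul_spec A.decon_mem_barSub (F.codRestrict A.barSub hsub x)).symm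
    rw [LinearMap.comp_apply, TensorProduct.mapIncl,
      ← LinearMap.comp_apply (TensorProduct.map _ _) (TensorProduct.map _ _),
      ← TensorProduct.map_comp, LinearMap.subtype_comp_codRestrict]
    exact LinearMap.congr_fun (Bar.comul_of_comp Y.coassoc hF) x
  · apply (TPow.zeroEquiv k V).injective
    have := hF 0 x
    rwa [TPow.map_zero_iterComul, Bar.comp_zero] at this

/-- A morphism into the reduced cofree colored coalgebra on `V` is determined, as a linear map,
by its composite with the projection to `V`. -/
lemma ColoredSpace.cofree_lin_ext {Y : RedColCoalg.{w, v} k} (A : ColoredSpace k H V)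
    {F F' : Y ⟶ RedColCoalg.of A.cofree}
    (h : A.cofreeProj ∘ₗ F.lin = A.cofreeProj ∘ₗ F'.lin) : F.lin = F'.lin := by
  have key : ∀ F : Y ⟶ RedColCoalg.of A.cofree,
      TensorProduct.map (A.barSub.subtype ∘ₗ F.lin) (A.barSub.subtype ∘ₗ F.lin) ∘ₗ Y.comul =
        Bar.decon k ∘ₗ A.barSub.subtype ∘ₗ F.lin := fun F => by
    rw [TensorProduct.map_comp, LinearMap.comp_assoc, F.map_comul, ← LinearMap.comp_assoc,
      ← LinearMap.comp_assoc]
    exact congrArg (· ∘ₗ F.lin) (restrictComul_spec' A.decon_mem_barSub)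
  have := Bar.comul_hom_ext (key F) (key F') h
  exact LinearMap.ext fun x => Subtype.ext (LinearMap.congr_fun this x)

end Lift

/-! ### Coequalizers -/

namespace RedColCoalg

variable {k : Type v} [Field k] {C D : RedColCoalg.{w, v} k}

@[ext]
lemma hom_ext {f g : C ⟶ D} (hc : f.color = g.color) (hl : f.lin = g.lin) : f = g :=
  Hom.ext hc hl

variable (f g : C ⟶ D)

lemma coarsePiece_le {s t : CoeqColor f g} {P : Submodule k D.carrier} :
    coarsePiece f g s t ≤ P ↔
      ∀ a b, Quot.mk _ a = s → Quot.mk _ b = t → D.piece a b ≤ P := by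
  simp only [coarsePiece, iSup_le_iff]

lemma piece_le_coarsePiece (a b : D.Color) :
    D.piece a b ≤ coarsePiece f g (Quot.mk _ a) (Quot.mk _ b) :=
  (coarsePiece_le f g).1 le_rfl a b rfl rfl

lemma range_sub_le {P : Submodule k D.carrier}
    (h : ∀ a b, ∀ x ∈ C.piece a b, f.lin x - g.lin x ∈ P) :
    LinearMap.range (f.lin - g.lin) ≤ P := by
  have h' : (⊤ : Submodule k C.carrier) ≤ P.comap (f.lin - g.lin) := by
    rw [← C.str.sup]
    exact iSup_le fun p x hx => h p.1 p.2 x hx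
  rintro _ ⟨x, rfl⟩
  exact h' trivial

/-- The comultiplication of `D` descends to `D / Im(f - g)`: the quotient map `q` satisfies
`q f = q g`, so `q ⊗ q` kills `Δ(f x - g x) = (f ⊗ f - g ⊗ g)(Δ x)`. -/
lemma range_sub_le_ker_comul :
    LinearMap.range (f.lin - g.lin) ≤ LinearMap.ker
      (TensorProduct.map (LinearMap.range (f.lin - g.lin)).mkQ
        (LinearMap.range (f.lin - g.lin)).mkQ ∘ₗ D.comul) := by
  rintro _ ⟨x, rfl⟩
  have h0 : (LinearMap.range (f.lin - g.lin)).mkQ ∘ₗ f.lin =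
      (LinearMap.range (f.lin - g.lin)).mkQ ∘ₗ g.lin := by
    rw [← sub_eq_zero, ← LinearMap.comp_sub, LinearMap.range_mkQ_comp]
  have hf := LinearMap.congr_fun f.map_comul x
  have hg := LinearMap.congr_fun g.map_comul x
  simp only [LinearMap.comp_apply] at hf hg
  rw [LinearMap.mem_ker, LinearMap.comp_apply, LinearMap.sub_apply, map_sub, ← hf, ← hg, map_sub,
    ← LinearMap.comp_apply (TensorProduct.map _ _), ← TensorProduct.map_comp, h0,
    ← LinearMap.comp_apply (TensorProduct.map _ _) (TensorProduct.map g.lin g.lin),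
    ← TensorProduct.map_comp, sub_self]

/-- The comultiplication induced on `D / Im(f - g)`. -/
noncomputable def coeqComul : CoeqSpace f g →ₗ[k] CoeqSpace f g ⊗[k] CoeqSpace f g :=
  (LinearMap.range (f.lin - g.lin)).liftQ _ (range_sub_le_ker_comul f g)

lemma map_mkQ_comp_comul :
    TensorProduct.map (LinearMap.range (f.lin - g.lin)).mkQ
      (LinearMap.range (f.lin - g.lin)).mkQ ∘ₗ D.comul =
        coeqComul f g ∘ₗ (LinearMap.range (f.lin - g.lin)).mkQ :=
  (Submodule.liftQ_mkQ _ _ _).symm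

lemma coeq_iSupIndep : iSupIndep fun p : CoeqColor f g × CoeqColor f g =>
    (coarsePiece f g p.1 p.2).map (LinearMap.range (f.lin - g.lin)).mkQ := by
  classical
  refine iSupIndep_of_proj _ fun ⟨s, t⟩ => ?_
  obtain ⟨e, he⟩ := D.str.exists_proj fun a b =>
    (Quot.mk _ a : CoeqColor f g) = s ∧ (Quot.mk _ b : CoeqColor f g) = t
  have hmk : ∀ a, (Quot.mk _ (f.color a) : CoeqColor f g) = Quot.mk _ (g.color a) :=
    fun a => Quot.sound ⟨a, rfl, rfl⟩
  -- `f - g` is homogeneous for the coarse grading, so the coarse projection acts on the quotient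
  have hle : LinearMap.range (f.lin - g.lin) ≤ (LinearMap.range (f.lin - g.lin)).comap e := by
    refine range_sub_le f g fun a b x hx => ?_
    rw [Submodule.mem_comap, map_sub, he _ _ _ (f.map_piece a b x hx),
      he _ _ _ (g.map_piece a b x hx), hmk, hmk]
    split_ifs
    · exact ⟨x, rfl⟩
    · simp
  refine ⟨Submodule.mapQ _ _ e hle, ?_, ?_⟩
  · rintro _ ⟨x, hx, rfl⟩
    have h : coarsePiece f g s t ≤ LinearMap.eqLocus e LinearMap.id :=
      (coarsePiece_le f g).2 fun a b ha hb x hx => by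
        rw [LinearMap.mem_eqLocus, he a b x hx, if_pos ⟨ha, hb⟩, LinearMap.id_apply]
    have hx' : e x = x := h hx
    simp [hx']
  · rintro ⟨s', t'⟩ hne _ ⟨x, hx, rfl⟩
    have h : coarsePiece f g s' t' ≤ LinearMap.ker e :=
      (coarsePiece_le f g).2 fun a b ha hb x hx => by
        rw [LinearMap.mem_ker, he a b x hx, if_neg]
        rintro ⟨ha', hb'⟩
        exact hne (Prod.ext (ha.symm.trans ha') (hb.symm.trans hb'))
    have hx' : e x = 0 := h hx
    simp [hx']

/-- The reduced colored coalgebra structure on `D / Im(f - g)`. -/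
noncomputable def coeqStr : ReducedColoredCoalgebra k (CoeqColor f g) (CoeqSpace f g) where
  piece s t := (coarsePiece f g s t).map (LinearMap.range (f.lin - g.lin)).mkQ
  indep := coeq_iSupIndep f g
  sup := by
    rw [← Submodule.map_iSup]
    have h : (⨆ p : CoeqColor f g × CoeqColor f g, coarsePiece f g p.1 p.2) = ⊤ := by
      rw [eq_top_iff, ← D.str.sup]
      exact iSup_le fun p => (piece_le_coarsePiece f g p.1 p.2).trans
        (le_iSup (fun p : CoeqColor f g × CoeqColor f g => coarsePiece f g p.1 p.2)
          (Quot.mk _ p.1, Quot.mk _ p.2))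
    rw [h, Submodule.map_top, Submodule.range_mkQ]
  comul := coeqComul f g
  coassoc := D.str.coassoc.of_surjective (map_mkQ_comp_comul f g) (Submodule.mkQ_surjective _)
  conilpotent :=
    D.str.conilpotent.of_surjective (map_mkQ_comp_comul f g) (Submodule.mkQ_surjective _)
  comul_piece := by
    rintro s t _ ⟨x, hx, rfl⟩
    rw [← LinearMap.comp_apply (coeqComul f g), ← map_mkQ_comp_comul]
    suffices H : coarsePiece f g s t ≤ Submodule.comap
        (TensorProduct.map (LinearMap.range (f.lin - g.lin)).mkQ
          (LinearMap.range (f.lin - g.lin)).mkQ ∘ₗ D.comul)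
        (⨆ r, tensorSub ((coarsePiece f g s r).map (LinearMap.range (f.lin - g.lin)).mkQ)
          ((coarsePiece f g r t).map (LinearMap.range (f.lin - g.lin)).mkQ)) from H hx
    rw [coarsePiece_le]
    rintro a b rfl rfl y hy
    have h : (⨆ c, tensorSub (D.piece a c) (D.piece c b)) ≤
        (⨆ r, tensorSub
          ((coarsePiece f g (Quot.mk _ a) r).map (LinearMap.range (f.lin - g.lin)).mkQ)
          ((coarsePiece f g r (Quot.mk _ b)).map (LinearMap.range (f.lin - g.lin)).mkQ)).comap
        (TensorProduct.map (LinearMap.range (f.lin - g.lin)).mkQ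
          (LinearMap.range (f.lin - g.lin)).mkQ) :=
      iSup_le fun c => tensorSub_le.2 fun u hu v hv =>
        Submodule.mem_iSup_of_mem (Quot.mk _ c) (tmul_mem_tensorSub
          (Submodule.mem_map_of_mem (piece_le_coarsePiece f g a c hu))
          (Submodule.mem_map_of_mem (piece_le_coarsePiece f g c b hv)))
    exact h (D.str.comul_piece a b y hy)

/-- The quotient morphism `D ⟶ D / Im(f - g)`. -/
noncomputable def coeqProj : D ⟶ of (coeqStr f g) :=
  { color := Quot.mk _
    lin := (LinearMap.range (f.lin - g.lin)).mkQ
    map_piece := fun a b _ hx => Submodule.mem_map_of_mem (piece_le_coarsePiece f g a b hx)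
    map_comul := map_mkQ_comp_comul f g : Hom D (of (coeqStr f g)) }

lemma coeqProj_condition : f ≫ coeqProj f g = g ≫ coeqProj f g := by
  apply hom_ext
  · exact funext fun a => Quot.sound ⟨a, rfl, rfl⟩
  · change (LinearMap.range (f.lin - g.lin)).mkQ ∘ₗ f.lin =
      (LinearMap.range (f.lin - g.lin)).mkQ ∘ₗ g.lin
    rw [← sub_eq_zero, ← LinearMap.comp_sub, LinearMap.range_mkQ_comp]

variable {f g} in
/-- The morphism out of `D / Im(f - g)` induced by a morphism that equalizes `f` and `g`. -/
noncomputable def coeqDesc {Y : RedColCoalg.{w, v} k} (h : D ⟶ Y) (e : f ≫ h = g ≫ h) :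
    of (coeqStr f g) ⟶ Y :=
  have hc : h.color ∘ f.color = h.color ∘ g.color := congrArg Hom.color e
  have hl : h.lin ∘ₗ f.lin = h.lin ∘ₗ g.lin := congrArg Hom.lin e
  have hle : LinearMap.range (f.lin - g.lin) ≤ LinearMap.ker h.lin := by
    rw [LinearMap.range_le_ker_iff, LinearMap.comp_sub, hl, sub_self]
  { color := Quot.lift h.color (by rintro _ _ ⟨x, rfl, rfl⟩; exact congrFun hc x)
    lin := (LinearMap.range (f.lin - g.lin)).liftQ h.lin hle
    map_piece := by
      rintro s t _ ⟨x, hx, rfl⟩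
      suffices H : coarsePiece f g s t ≤ (Y.piece (Quot.lift h.color _ s)
          (Quot.lift h.color _ t)).comap h.lin from H hx
      rw [coarsePiece_le]
      rintro a b rfl rfl y hy
      exact h.map_piece a b y hy
    map_comul := by
      refine Submodule.linearMap_qext _ ?_
      rw [LinearMap.comp_assoc, LinearMap.comp_assoc, Submodule.liftQ_mkQ, ← h.map_comul]
      change _ ∘ₗ coeqComul f g ∘ₗ _ = _
      rw [← map_mkQ_comp_comul, ← LinearMap.comp_assoc, ← TensorProduct.map_comp,
        Submodule.liftQ_mkQ] : Hom (of (coeqStr f g)) Y }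

/-- `D / Im(f - g)` is the coequalizer of `f` and `g`. -/
noncomputable def coeqIsColimit :
    IsColimit (Cofork.ofπ (coeqProj f g) (coeqProj_condition f g)) :=
  Cofork.IsColimit.mk _ (fun s => coeqDesc s.π s.condition)
    (fun s => hom_ext (funext fun _ => rfl) (Submodule.liftQ_mkQ _ _ _))
    (fun s m hm => by
      apply hom_ext
      · funext q
        induction q using Quot.ind with
        | mk a => exact congrFun (congrArg Hom.color hm) a
      · refine Submodule.linearMap_qext _ ?_
        exact (congrArg Hom.lin hm).trans (Submodule.liftQ_mkQ _ _ _).symm)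

instance : HasCoequalizers (RedColCoalg.{w, v} k) :=
  have : ∀ {C D : RedColCoalg.{w, v} k} {f g : C ⟶ D}, HasColimit (parallelPair f g) :=
    fun {_ _ f g} => ⟨_, coeqIsColimit f g⟩
  hasCoequalizers_of_hasColimit_parallelPair _

end RedColCoalg

/-! ### Linear maps out of a colored vector space -/

lemma ColoredSpace.exists_linearMap {k : Type v} [Field k] {G V W : Type w} [AddCommGroup V]
    [Module k V] [AddCommGroup W] [Module k W] (A : ColoredSpace k G V)
    (ℓ : ∀ g h, A.piece g h →ₗ[k] W) :
    ∃ φ : V →ₗ[k] W, ∀ g h, ∀ x : A.piece g h, φ x = ℓ g h x := by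
  classical
  have hI : DirectSum.IsInternal (fun p : G × G => A.piece p.1 p.2) :=
    (DirectSum.isInternal_submodule_iff_iSupIndep_and_iSup_eq_top _).2 ⟨A.indep, A.sup⟩
  let E := LinearEquiv.ofBijective
    (DirectSum.coeLinearMap (fun p : G × G => A.piece p.1 p.2)) hI
  refine ⟨DirectSum.toModule k (G × G) W (fun p => ℓ p.1 p.2) ∘ₗ E.symm.toLinearMap, ?_⟩
  intro g h x
  have : E.symm x = DirectSum.lof k (G × G) (fun p => A.piece p.1 p.2) (g, h) x := by
    rw [LinearEquiv.symm_apply_eq]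
    exact (DirectSum.coeLinearMap_lof (fun p : G × G => A.piece p.1 p.2) (g, h) x).symm
  simp only [LinearMap.comp_apply, LinearEquiv.coe_coe, this, DirectSum.toModule_lof]

lemma ColoredSpace.linearMap_ext {k : Type v} [Field k] {G V W : Type w} [AddCommGroup V]
    [Module k V] [AddCommGroup W] [Module k W] (A : ColoredSpace k G V) {φ ψ : V →ₗ[k] W}
    (h : ∀ a b, ∀ x ∈ A.piece a b, φ x = ψ x) : φ = ψ := by
  have h' : (⊤ : Submodule k V) ≤ LinearMap.eqLocus φ ψ := by
    rw [← A.sup]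
    exact iSup_le fun p x hx => h p.1 p.2 x hx
  exact LinearMap.ext fun x => h' trivial

namespace RedColCoalg

/-! ### Subcoalgebras as reduced colored coalgebras -/

section Sub

variable {k : Type v} [Field k] {X : RedColCoalg.{w, v} k} {E : Submodule k X.carrier}

lemma IsSubcoalgebra.exists_proj (hE : X.IsSubcoalgebra E) (g h : X.Color) :
    ∃ e : X.carrier →ₗ[k] X.carrier,
      (∀ x ∈ E, e x ∈ E ⊓ X.piece g h) ∧ (∀ x ∈ X.piece g h, e x = x) ∧
        ∀ a b, ¬(a = g ∧ b = h) → ∀ x ∈ X.piece a b, e x = 0 := by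
  classical
  obtain ⟨e, he⟩ := X.str.exists_proj fun a b => a = g ∧ b = h
  refine ⟨e, fun x hx => ?_, fun x hx => by rw [he g h x hx, if_pos ⟨rfl, rfl⟩],
    fun a b hab x hx => by rw [he a b x hx, if_neg hab]⟩
  have hle : (⨆ p : X.Color × X.Color, E ⊓ X.piece p.1 p.2) ≤ (E ⊓ X.piece g h).comap e := by
    refine iSup_le fun ⟨a, b⟩ x hx => ?_
    rw [Submodule.mem_comap, he a b x hx.2]
    split_ifs with hab
    · obtain ⟨rfl, rfl⟩ := hab
      exact hx
    · exact Submodule.zero_mem _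
  exact hle (hE.homogeneous hx)

/-- In a subcoalgebra `E`, the comultiplication of an element of bidegree `(g, h)` can be written
with homogeneous tensors whose factors lie in `E`: apply `∑ₛ eₛ ⊗ e'ₛ` to it, where `eₛ` and `e'ₛ`
are the projections to the bidegrees `(g, s)` and `(s, h)`, which preserve `E`. -/
lemma IsSubcoalgebra.comul_mem_iSup (hE : X.IsSubcoalgebra E) (g h : X.Color) {x : X.carrier}
    (hx : x ∈ E) (hgh : x ∈ X.piece g h) :
    X.comul x ∈ ⨆ s, tensorSub (E ⊓ X.piece g s) (E ⊓ X.piece s h) := by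
  classical
  choose e he he1 he0 using hE.exists_proj
  -- only finitely many middle colors `s` occur in `Δ x`
  have key : ∀ t ∈ ⨆ s, tensorSub (X.piece g s) (X.piece s h), ∃ r : Finset X.Color,
      ∀ r', r ⊆ r' → ∑ s ∈ r', TensorProduct.map (e g s) (e s h) t = t := by
    intro t ht
    induction ht using Submodule.iSup_induction' with
    | zero => exact ⟨∅, fun r' _ => by simp⟩
    | add a b _ _ ha hb =>
      obtain ⟨r, hr⟩ := ha
      obtain ⟨q, hq⟩ := hb
      refine ⟨r ∪ q, fun r' h' => ?_⟩
      simp only [map_add, Finset.sum_add_distrib]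
      rw [hr r' (Finset.union_subset_left h'), hq r' (Finset.union_subset_right h')]
    | mem s t ht =>
      refine ⟨{s}, fun r' h' => ?_⟩
      suffices H : tensorSub (X.piece g s) (X.piece s h) ≤ LinearMap.eqLocus
          (∑ s ∈ r', TensorProduct.map (e g s) (e s h)) LinearMap.id by
        simpa [LinearMap.sum_apply] using H ht
      refine tensorSub_le.2 fun y hy z hz => ?_
      rw [LinearMap.mem_eqLocus, LinearMap.sum_apply, LinearMap.id_apply,
        Finset.sum_eq_single_of_mem s (h' (Finset.mem_singleton_self s))]
      · rw [TensorProduct.map_tmul, he1 _ _ y hy, he1 _ _ z hz]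
      · intro c _ hc
        rw [TensorProduct.map_tmul, he0 _ _ _ _ (fun H => hc H.2.symm) y hy,
          TensorProduct.zero_tmul]
  obtain ⟨r, hr⟩ := key _ (X.str.comul_piece g h x hgh)
  rw [← hr r subset_rfl]
  refine Submodule.sum_mem _ fun s _ => Submodule.mem_iSup_of_mem s ?_
  have hle : tensorSub E E ≤ (tensorSub (E ⊓ X.piece g s) (E ⊓ X.piece s h)).comap
      (TensorProduct.map (e g s) (e s h)) :=
    tensorSub_le.2 fun y hy z hz => by
      rw [Submodule.mem_comap, TensorProduct.map_tmul]
      exact tmul_mem_tensorSub (he g s y hy) (he s h z hz)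
  exact hle (hE.comul_mem x hx)

/-- A subcoalgebra is a reduced colored coalgebra with the restricted bigrading and
comultiplication. -/
noncomputable def IsSubcoalgebra.restrict (hE : X.IsSubcoalgebra E) :
    ReducedColoredCoalgebra k X.Color E where
  piece g h := (X.piece g h).comap E.subtype
  indep := iSupIndep_restrict E X.str.indep
  sup := by
    have h := iSup_restrict E (fun p : X.Color × X.Color => E ⊓ X.piece p.1 p.2)
      (le_antisymm hE.homogeneous (iSup_le fun _ => inf_le_left))
    simpa only [Submodule.comap_inf, Submodule.comap_subtype_self, top_inf_eq] using h
  comul := restrictComul X.comul E hE.comul_mem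
  coassoc := restrictComul_coassoc _ X.str.coassoc
  conilpotent := restrictComul_conilpotent _ X.str.conilpotent
  comul_piece g h x hx := by
    have H := mem_iSup_restrict E (fun s => E ⊓ X.piece g s) (fun s => E ⊓ X.piece s h)
      (fun s => inf_le_left) (fun s => inf_le_left) (restrictComul X.comul E hE.comul_mem x) (by
        rw [restrictComul_spec]
        exact hE.comul_mem_iSup g h x.2 hx)
    simpa only [Submodule.comap_inf, Submodule.comap_subtype_self, top_inf_eq] using H

/-- The inclusion of a subcoalgebra. -/
noncomputable def IsSubcoalgebra.incl (hE : X.IsSubcoalgebra E) : of hE.restrict ⟶ X :=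
  { color := id
    lin := E.subtype
    map_piece := fun _ _ _ hx => hx
    map_comul := restrictComul_spec' hE.comul_mem : Hom (of hE.restrict) X }

lemma isSubcoalgebra_sSup {S : Set (Submodule k X.carrier)} (hS : ∀ E ∈ S, X.IsSubcoalgebra E) :
    X.IsSubcoalgebra (sSup S) where
  homogeneous := sSup_le fun E hE => (hS E hE).homogeneous.trans
    (iSup_mono fun _ => inf_le_inf_right _ (le_sSup hE))
  comul_mem := by
    have h : sSup S ≤ (tensorSub (sSup S) (sSup S)).comap X.comul :=
      sSup_le fun E hE x hx => tensorSub_mono (le_sSup hE) (le_sSup hE) ((hS E hE).comul_mem x hx)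
    exact fun x hx => h hx

lemma isSubcoalgebra_range {Y : RedColCoalg.{w, v} k} (F : Y ⟶ X) :
    X.IsSubcoalgebra (LinearMap.range F.lin) where
  homogeneous := by
    rw [LinearMap.range_eq_map, ← Y.str.sup, Submodule.map_iSup]
    refine iSup_le fun p => le_iSup_of_le (F.color p.1, F.color p.2) (le_inf ?_ ?_)
    · exact le_iSup (fun p : Y.Color × Y.Color => (Y.piece p.1 p.2).map F.lin) p
    · rintro _ ⟨x, hx, rfl⟩
      exact F.map_piece _ _ x hx
  comul_mem := by
    rintro _ ⟨y, rfl⟩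
    have h : (⊤ : Submodule k (Y.carrier ⊗[k] Y.carrier)) ≤
        (tensorSub (LinearMap.range F.lin) (LinearMap.range F.lin)).comap
          (TensorProduct.map F.lin F.lin) := by
      rintro t -
      induction t with
      | zero => exact Submodule.zero_mem _
      | add a b ha hb => exact Submodule.add_mem _ ha hb
      | tmul a b => exact tmul_mem_tensorSub ⟨a, rfl⟩ ⟨b, rfl⟩
    rw [← LinearMap.comp_apply X.comul, ← F.map_comul]
    exact h trivial

end Sub

end RedColCoalg

/-! ### Products -/

section ColoredProduct

variable {k : Type v} [Field k] {ι : Type w} {G V : ι → Type w} [∀ i, AddCommGroup (V i)]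
  [∀ i, Module k (V i)] (A : ∀ i, ColoredSpace k (G i) (V i))

lemma coloredProdProj_mem (i : ι) {g h : ∀ i, G i} {x : ColoredProd A}
    (hx : x ∈ (coloredProd A).piece g h) : coloredProdProj A i x ∈ (A i).piece (g i) (h i) := by
  classical
  obtain ⟨y, rfl⟩ := hx
  simp [coloredProdProj]

lemma coloredProd_ext {g h : ∀ i, G i} {x y : ColoredProd A}
    (hx : x ∈ (coloredProd A).piece g h) (hy : y ∈ (coloredProd A).piece g h)
    (hxy : ∀ i, coloredProdProj A i x = coloredProdProj A i y) : x = y := by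
  classical
  obtain ⟨x, rfl⟩ := hx
  obtain ⟨y, rfl⟩ := hy
  congr 1
  ext i
  simpa [coloredProdProj] using hxy i

/-- The universal property of the product of colored vector spaces. -/
lemma exists_coloredProd_lift {H W : Type w} [AddCommGroup W] [Module k W]
    (B : ColoredSpace k H W) (c : H → ∀ i, G i) (f : ∀ i, W →ₗ[k] V i)
    (hf : ∀ i a b, ∀ x ∈ B.piece a b, f i x ∈ (A i).piece (c a i) (c b i)) :
    ∃ φ : W →ₗ[k] ColoredProd A,
      (∀ a b, ∀ x ∈ B.piece a b, φ x ∈ (coloredProd A).piece (c a) (c b)) ∧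
        ∀ i, coloredProdProj A i ∘ₗ φ = f i := by
  classical
  obtain ⟨φ, hφ⟩ := B.exists_linearMap fun a b =>
    DirectSum.lof k ((∀ i, G i) × (∀ i, G i)) (fun p => ∀ i, (A i).piece (p.1 i) (p.2 i))
      (c a, c b) ∘ₗ LinearMap.pi fun i => (f i).restrict (hf i a b)
  refine ⟨φ, fun a b x hx => ?_, fun i => B.linearMap_ext fun a b x hx => ?_⟩
  · rw [hφ a b ⟨x, hx⟩]
    exact ⟨_, rfl⟩
  · rw [LinearMap.comp_apply, hφ a b ⟨x, hx⟩]
    simp [coloredProdProj]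

end ColoredProduct

namespace RedColCoalg

variable {k : Type v} [Field k] {ι : Type w} (X : ι → RedColCoalg.{w, v} k)

lemma prodSub_isCompatible : IsCompatible X (prodSub X) where
  isSubcoalgebra := isSubcoalgebra_sSup fun _ hE => hE.isSubcoalgebra
  comul_proj i := by
    have h : prodSub X ≤ LinearMap.eqLocus
        (TensorProduct.map (cofreeProdProj X i) (cofreeProdProj X i) ∘ₗ (cofreeProd X).comul)
        ((X i).comul ∘ₗ cofreeProdProj X i) :=
      sSup_le fun E hE x hx => hE.comul_proj i x hx
    exact fun x hx => h hx

lemma cofreeProdProj_mem (i : ι) {g h : ∀ i, (X i).Color} {x : (cofreeProd X).carrier}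
    (hx : x ∈ (cofreeProd X).piece g h) : cofreeProdProj X i x ∈ (X i).piece (g i) (h i) :=
  coloredProdProj_mem _ i (ColoredSpace.proj_mem_piece _ hx)

/-- The largest compatible subcoalgebra of the cofree object, as a reduced colored coalgebra. -/
noncomputable abbrev prodObj : RedColCoalg.{w, v} k :=
  of (prodSub_isCompatible X).isSubcoalgebra.restrict

/-- The projections of the product. -/
noncomputable def prodProj (i : ι) : prodObj X ⟶ X i :=
  { color := fun s => s i
    lin := cofreeProdProj X i ∘ₗ (prodSub X).subtype
    map_piece := fun _ _ _ hx => cofreeProdProj_mem X i hx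
    map_comul := by
      rw [TensorProduct.map_comp, LinearMap.comp_assoc]
      change _ ∘ₗ _ ∘ₗ restrictComul _ _ (prodSub_isCompatible X).isSubcoalgebra.comul_mem = _
      rw [restrictComul_spec' (prodSub_isCompatible X).isSubcoalgebra.comul_mem]
      exact LinearMap.ext fun x => (prodSub_isCompatible X).comul_proj i x x.2 :
      Hom (prodObj X) (X i) }

variable {X} in
/-- A family of morphisms `Y ⟶ Xᵢ` lifts to the cofree object by the two universal properties; the
image of the lift is a compatible subcoalgebra, so it lies in the largest one. -/
lemma exists_prodLift {Y : RedColCoalg.{w, v} k} (f : ∀ i, Y ⟶ X i) :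
    ∃ F : Y ⟶ prodObj X, ∀ i, F ≫ prodProj X i = f i := by
  let A := coloredProd fun i => (X i).str.toColoredSpace
  obtain ⟨φ, hφ, hφf⟩ := exists_coloredProd_lift (fun i => (X i).str.toColoredSpace)
    Y.str.toColoredSpace (fun a i => (f i).color a) (fun i => (f i).lin)
    (fun i a b x hx => (f i).map_piece a b x hx)
  obtain ⟨F, hFc, hF⟩ := A.exists_cofree_lift Y.str _ φ hφ
  have hFf : ∀ i, cofreeProdProj X i ∘ₗ F.lin = (f i).lin := fun i => by
    rw [← hφf i, ← hF]
    rfl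
  have hcomp : IsCompatible X (LinearMap.range F.lin) :=
    { isSubcoalgebra := isSubcoalgebra_range F
      comul_proj := by
        rintro i _ ⟨y, rfl⟩
        have h1 := LinearMap.congr_fun F.map_comul y
        have h2 := LinearMap.congr_fun (f i).map_comul y
        simp only [LinearMap.comp_apply] at h1 h2
        refine (congrArg _ h1.symm).trans ?_
        rw [← LinearMap.comp_apply (TensorProduct.map _ _), ← TensorProduct.map_comp, hFf,
          ← LinearMap.comp_apply (cofreeProdProj X i), hFf]
        exact h2 }
  have hmem : ∀ y, F.lin y ∈ prodSub X := fun y =>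
    le_sSup (a := LinearMap.range F.lin) hcomp ⟨y, rfl⟩
  refine ⟨{ color := F.color
            lin := F.lin.codRestrict (prodSub X) hmem
            map_piece := fun a b x hx => F.map_piece a b x hx
            map_comul := ?_ }, fun i => hom_ext ?_ ?_⟩
  · refine LinearMap.ext fun y => mapIncl_injective _ _ ?_
    refine Eq.trans ?_ (restrictComul_spec
      (prodSub_isCompatible X).isSubcoalgebra.comul_mem ⟨F.lin y, hmem y⟩).symm
    rw [LinearMap.comp_apply, TensorProduct.mapIncl,
      ← LinearMap.comp_apply (TensorProduct.map _ _) (TensorProduct.map _ _),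
      ← TensorProduct.map_comp, LinearMap.subtype_comp_codRestrict]
    exact LinearMap.congr_fun F.map_comul y
  · funext a
    exact congrFun (congrFun hFc a) i
  · exact hFf i

variable {X} in
lemma prod_hom_ext {Y : RedColCoalg.{w, v} k} {F F' : Y ⟶ prodObj X}
    (h : ∀ i, F ≫ prodProj X i = F' ≫ prodProj X i) : F = F' := by
  have hc : F.color = F'.color := funext fun a => funext fun i =>
    congrFun (congrArg Hom.color (h i)) a
  refine hom_ext hc ?_
  let J := (prodSub_isCompatible X).isSubcoalgebra.incl
  -- on each piece of `Y` the images under `F` and `F'` have the same bidegree, so their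
  -- projections to the product of colored spaces agree once all the coordinates do
  have hproj : ColoredSpace.cofreeProj _ ∘ₗ (F ≫ J).lin =
      ColoredSpace.cofreeProj _ ∘ₗ (F' ≫ J).lin := by
    refine Y.str.linearMap_ext fun a b x hx => ?_
    refine coloredProd_ext _ (ColoredSpace.proj_mem_piece _ ((F ≫ J).map_piece a b x hx))
      ?_ fun i => LinearMap.congr_fun (congrArg Hom.lin (h i)) x
    have h' := ColoredSpace.proj_mem_piece _ ((F' ≫ J).map_piece a b x hx)
    rw [show (F ≫ J).color = (F' ≫ J).color from hc]
    exact h'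
  have hl := ColoredSpace.cofree_lin_ext _ hproj
  exact LinearMap.ext fun x => Subtype.ext (LinearMap.congr_fun hl x)

/-- The largest compatible subcoalgebra of the cofree object is the product of the family. -/
noncomputable def prodIsLimit : IsLimit (Fan.mk (prodObj X) (prodProj X)) :=
  Fan.IsLimit.mk _ (fun s => (exists_prodLift s.proj).choose)
    (fun s => (exists_prodLift s.proj).choose_spec)
    (fun s _ hm => prod_hom_ext fun i =>
      (hm i).trans ((exists_prodLift s.proj).choose_spec i).symm)

instance : HasProducts.{w} (RedColCoalg.{w, v} k) :=
  hasProducts_of_limit_fans (fun X => Fan.mk (prodObj X) (prodProj X)) prodIsLimit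

end RedColCoalg

end RedCol

theorem mainTheorem4 (k : Type v) [Field k] :
    -- all small coequalizers and all small products exist
    (HasCoequalizers (RedCol.RedColCoalg.{w, v} k) ∧
      HasProducts.{w} (RedCol.RedColCoalg.{w, v} k)) ∧
    -- the coequalizer of `f, g` is carried by `D / Im(f - g)` and the quotient color set
    (∀ (C D : RedCol.RedColCoalg.{w, v} k) (f g : C ⟶ D),
      ∃ (q : RedCol.ReducedColoredCoalgebra k (RedCol.RedColCoalg.CoeqColor f g)
          (RedCol.RedColCoalg.CoeqSpace f g))
        (π : D ⟶ RedCol.RedColCoalg.of q) (hπ : f ≫ π = g ≫ π),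
        (∀ s : D.Color, π.color s = Quot.mk _ s) ∧
        π.lin = (LinearMap.range (f.lin - g.lin)).mkQ ∧
        (∀ s t : RedCol.RedColCoalg.CoeqColor f g, q.piece s t =
          (RedCol.RedColCoalg.coarsePiece f g s t).map (LinearMap.range (f.lin - g.lin)).mkQ) ∧
        Nonempty (IsColimit (Cofork.ofπ π hπ))) ∧
    -- the product is the largest compatible subcoalgebra of the reduced cofree colored coalgebra
    (∀ (ι : Type w) (X : ι → RedCol.RedColCoalg.{w, v} k),
      IsGreatest {E | RedCol.RedColCoalg.IsCompatible X E} (RedCol.RedColCoalg.prodSub X) ∧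
      ∃ (d : RedCol.ReducedColoredCoalgebra k (∀ i, (X i).Color) (RedCol.RedColCoalg.prodSub X))
        (j : RedCol.RedColCoalg.of d ⟶ RedCol.RedColCoalg.cofreeProd X)
        (p : ∀ i, RedCol.RedColCoalg.of d ⟶ X i),
        j.color = id ∧
        j.lin = (RedCol.RedColCoalg.prodSub X).subtype ∧
        (∀ s t : (∀ i, (X i).Color), d.piece s t =
          ((RedCol.RedColCoalg.cofreeProd X).piece s t).comap
            (RedCol.RedColCoalg.prodSub X).subtype) ∧
        (∀ i, (p i).color = fun s => s i) ∧
        (∀ i, (p i).lin =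
          RedCol.RedColCoalg.cofreeProdProj X i ∘ₗ (RedCol.RedColCoalg.prodSub X).subtype) ∧
        Nonempty (IsLimit (Fan.mk (RedCol.RedColCoalg.of d) p))) := by
  exact ⟨⟨inferInstance, inferInstance⟩,
    fun C D f g => ⟨RedCol.RedColCoalg.coeqStr f g, RedCol.RedColCoalg.coeqProj f g,
      RedCol.RedColCoalg.coeqProj_condition f g, fun _ => rfl, rfl, fun _ _ => rfl,
      ⟨RedCol.RedColCoalg.coeqIsColimit f g⟩⟩,
    fun ι X =>
      have h := RedCol.RedColCoalg.prodSub_isCompatible X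
      ⟨⟨h, fun _ hE => le_sSup hE⟩, h.isSubcoalgebra.restrict, h.isSubcoalgebra.incl,
        RedCol.RedColCoalg.prodProj X, rfl, rfl, fun _ _ => rfl, fun _ => rfl, fun _ => rfl,
        ⟨RedCol.RedColCoalg.prodIsLimit X⟩⟩⟩
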